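/- Let $G$ be a compact connected Lie group and $K\subset G$ a closed subgroup such that $G/K$ is an irreducible odd-dimensional symmetric space: there is a smooth involutive automorphism $\sigma$ of $G$ with $(G^\sigma)_0\subset K\subset G^\sigma$, and the isotropy representation of $K$ on the tangent space of $G/K$ at the base point is irreducible. Assume that $\operatorname{rank} K=\operatorname{rank} G-1$, where the rank is the dimension of a maximal torus. Let $T\subset G$ be a maximal torus of $G$ which contains a maximal torus of $K$ (for instance, such that $T\cap K$ is a maximal torus of $K$). Put $W_G(T):=N_G(T)/T$ and $W_K(T):=N_K(T)/(T\cap K)$, where $N_K(T)=N_G(T)\cap K$; the latter is a subgroup of $W_G(T)$ through the inclusion $N_K(T)\subset N_G(T)$. Let $W_G(T)/W_K(T)$ denote the set of orbits $W_K(T)\,w$ of $W_K(T)$ acting on $W_G(T)$ by left multiplication. Then $$N_G(T)\ni g\mapsto T g^{-1}K\subset G/K$$ induces a well-defined bijection from $W_G(T)/W_K(T)$ onto the set of one-dimensional $T$-orbits in $G/K$. -/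

import Mathlib

open scoped Manifold ContDiff

noncomputable section

namespace SymOrbits

/-! ### Tori, maximal tori, rank -/

section Tori

variable {G : Type*} [Group G] [TopologicalSpace G]

/-- `A` is isomorphic, as a topological group, to the `n`-dimensional torus. -/
def IsTorusOfDim (A : Subgroup G) (n : ℕ) : Prop :=
  Nonempty (A ≃ₜ* (Fin n → Circle))

/-- `A` is a torus: it is isomorphic to some finite product of circles. -/
def IsTorus (A : Subgroup G) : Prop := ∃ n : ℕ, IsTorusOfDim A n

/-- `A` is a maximal torus of the subgroup `H` of `G`
(maximal with respect to inclusion among the tori contained in `H`). -/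
def IsMaximalTorus (H A : Subgroup G) : Prop :=
  Maximal (fun B : Subgroup G => B ≤ H ∧ IsTorus B) A

/-- `H` has rank `r`: it has a maximal torus of dimension `r`. -/
def HasRank (H : Subgroup G) (r : ℕ) : Prop :=
  ∃ A : Subgroup G, IsMaximalTorus H A ∧ IsTorusOfDim A r

end Tori

/-! ### Dimension -/

/-- `X` is locally homeomorphic to `ℝⁿ`. -/
def IsLocallyEuclideanOfDim (X : Type*) [TopologicalSpace X] (n : ℕ) : Prop :=
  Nonempty (ChartedSpace (EuclideanSpace ℝ (Fin n)) X)

/-! ### Weyl groups -/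

section Weyl

variable {G : Type*} [Group G]

/-- The Weyl group `W_G(T) = N_G(T) / T`. -/
abbrev WeylGroup (T : Subgroup G) : Type _ :=
  Subgroup.normalizer (T : Set G) ⧸ T.subgroupOf (Subgroup.normalizer (T : Set G))

/-- The normalizer `N_K(T) = N_G(T) ∩ K` of `T` in the subgroup `K`. -/
abbrev normalizerIn (K T : Subgroup G) : Subgroup G :=
  Subgroup.normalizer (T : Set G) ⊓ K

instance interNormal (K T : Subgroup G) :
    ((T ⊓ K).subgroupOf (normalizerIn K T)).Normal where
  conj_mem := by
    rintro ⟨n, hn⟩ hmem ⟨g, hg⟩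
    rw [Subgroup.mem_subgroupOf] at hmem ⊢
    exact ⟨(Subgroup.mem_normalizer_iff.mp hg.1 n).mp hmem.1,
      K.mul_mem (K.mul_mem hg.2 hmem.2) (K.inv_mem hg.2)⟩

/-- The group `W_K(T) = N_K(T) / (T ∩ K)`. -/
abbrev WeylGroupIn (K T : Subgroup G) : Type _ :=
  normalizerIn K T ⧸ (T ⊓ K).subgroupOf (normalizerIn K T)

/-- The natural homomorphism `W_K(T) → W_G(T)` induced by the inclusion `N_K(T) ⊆ N_G(T)`. -/
def weylMap (K T : Subgroup G) : WeylGroupIn K T →* WeylGroup T :=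
  QuotientGroup.map _ _ (Subgroup.inclusion inf_le_left) (fun _ hx => hx.1)

/-- `W_K(T)` is a subgroup of `W_G(T)`. -/
theorem weylMap_injective (K T : Subgroup G) : Function.Injective (weylMap K T) := by
  rw [injective_iff_map_eq_one]
  intro x
  induction x using QuotientGroup.induction_on with
  | H z =>
    intro h
    have h' : (QuotientGroup.mk (Subgroup.inclusion inf_le_left z) : WeylGroup T) = 1 := h
    rw [QuotientGroup.eq_one_iff] at h' ⊢
    exact ⟨h', z.2.2⟩

/-- The coset space of `W_G(T)` modulo `W_K(T)`: the set of orbits `W_K(T) w` of the subgroup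
`W_K(T)` acting on `W_G(T)` by left multiplication. -/
abbrev WeylQuotient (K T : Subgroup G) : Type _ :=
  Quotient (QuotientGroup.rightRel (weylMap K T).range)

/-- The class in `W_G(T) / W_K(T)` of an element `g` of `N_G(T)`. -/
def weylClass (K T : Subgroup G) (g : Subgroup.normalizer (T : Set G)) : WeylQuotient K T :=
  Quotient.mk _ (QuotientGroup.mk g : WeylGroup T)

end Weyl

/-! ### One-dimensional orbits -/

/-- The one-dimensional `T`-orbits in `G / K`, as subsets of `G / K`. -/
def oneDimOrbits {G : Type*} [Group G] [TopologicalSpace G] (T K : Subgroup G) :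
    Set (Set (G ⧸ K)) :=
  {O | (∃ x : G ⧸ K, O = MulAction.orbit T x) ∧ IsLocallyEuclideanOfDim O 1}

/-! ### Symmetric spaces -/

section Symmetric

variable {E : Type*} [NormedAddCommGroup E] [NormedSpace ℝ E]
  {G : Type*} [Group G] [TopologicalSpace G] [ChartedSpace E G]

/-- The differential at the identity of a map `φ : G → G` which fixes the identity, as an
endomorphism of the Lie algebra of `G`. -/
def differentialAtOne (φ : G → G) :
    GroupLieAlgebra 𝓘(ℝ, E) G →ₗ[ℝ] GroupLieAlgebra 𝓘(ℝ, E) G :=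
  (mfderiv 𝓘(ℝ, E) 𝓘(ℝ, E) φ (1 : G)).toLinearMap

/-- The adjoint action `Ad g` on the Lie algebra of `G`. -/
def adjointAction (g : G) : GroupLieAlgebra 𝓘(ℝ, E) G →ₗ[ℝ] GroupLieAlgebra 𝓘(ℝ, E) G :=
  differentialAtOne (fun x : G => g * x * g⁻¹)

variable (E) in
/-- `G / K` is a symmetric space with respect to the smooth involutive automorphism `σ` of `G`:
the closed subgroup `K` lies between the fixed point group of `σ` and its identity component. -/
structure IsSymmetricPair (σ : G →* G) (K : Subgroup G) : Prop where
  smooth : ContMDiff 𝓘(ℝ, E) 𝓘(ℝ, E) ∞ σ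
  involutive : ∀ x, σ (σ x) = x
  isClosed : IsClosed (K : Set G)
  component_subset : connectedComponentIn {x : G | σ x = x} 1 ⊆ (K : Set G)
  fixed : ∀ k ∈ K, σ k = k

variable (E) in
/-- The `(-1)`-eigenspace `𝔭` of the differential of `σ` on the Lie algebra of `G`. For a symmetric
pair the Lie algebra of `K` is the `(+1)`-eigenspace, so that `𝔭`, with the adjoint action of `K`,
is the isotropy representation of `K` on the tangent space of `G / K` at the base point. -/
def isotropySpace (σ : G →* G) : Submodule ℝ (GroupLieAlgebra 𝓘(ℝ, E) G) :=
  Module.End.eigenspace (differentialAtOne (E := E) σ) (-1)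

variable (E) in
/-- `G / K` is an irreducible symmetric space: it is a symmetric space whose isotropy
representation is irreducible (non-zero, without proper non-zero invariant subspaces). -/
def IsIrreducibleSymmetricSpace (K : Subgroup G) : Prop :=
  ∃ σ : G →* G, IsSymmetricPair E σ K ∧ isotropySpace E σ ≠ ⊥ ∧
    ∀ V : Submodule ℝ (GroupLieAlgebra 𝓘(ℝ, E) G), V ≤ isotropySpace E σ →
      (∀ k ∈ K, V.map (adjointAction (E := E) k) ≤ V) → V = ⊥ ∨ V = isotropySpace E σ

end Symmetric

end SymOrbits

end

/-! The stabilizer in `T` of a point `aK` is the closed subgroup `T ⊓ aKa⁻¹`, so the orbit is a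
torus of dimension `rank G - dim (T ⊓ aKa⁻¹)`. Let `r = rank K` and let `S` be a maximal torus of
`K` inside `T`. Since `rank G = r + 1`, the orbit is one-dimensional exactly when `T ⊓ aKa⁻¹` has
dimension `r` (`isLocallyEuclideanOfDim_orbit_iff`). This is the largest possible value, because a
torus of `aKa⁻¹` has dimension at most `r`.

If `a` normalizes `T`, the stabilizer contains `aSa⁻¹`, so its dimension is `r`
(`finrank_lie_stabilizer`). Conversely, if the dimension is `r`, the identity component `D` of the
stabilizer gives a torus `a⁻¹Da` of `K`, which some `k ∈ K` conjugates into `S`, and onto `S` by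
dimension. Then `S` lies both in `T` and in the conjugate of `T` by `ka⁻¹`. Only one maximal torus
of `G` contains `S`, so `ka⁻¹` normalizes `T`, while `(ka⁻¹)⁻¹K = aK` (`exists_mem_normalizer`).
That two elements of `N_G(T)` give the same orbit iff they give the same coset is a computation
(`weylClass_eq_iff_orbit_eq`).

Two facts on tori carry this. Every torus of `K` is conjugate in `K` into `S` (`exists_conj_le`);
this is Hunt's argument, maximizing an invariant inner product over `K`. The uniqueness statement
`maximalTorus_unique` holds because the centralizer of `S` in the Lie algebra is abelian
(`bracket_eq_zero_of_commute`).

The Lie theory is derived from coordinates at the identity: one-parameter subgroups are limits of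
powers of small elements, the bracket is the second-order part of the commutator, and Lie algebras
of subgroups are needed only for abelian subgroups. -/

noncomputable section

open Filter Topology

namespace SymOrbits

/-! ### Second-order calculus for functions of two variables -/

section Calculus

variable {E : Type*} [NormedAddCommGroup E] [NormedSpace ℝ E]

/-- The mixed second derivative at the origin of a function of two variables. -/
def mixedDeriv (f : E × E → E) : E →L[ℝ] E →L[ℝ] E :=
  (fderiv ℝ (fun z => (fderiv ℝ f z).comp (ContinuousLinearMap.inr ℝ E E)) 0).comp
    (ContinuousLinearMap.inl ℝ E E)

theorem contDiffAt_partial {f : E × E → E} (hf : ContDiffAt ℝ 2 f 0) :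
    ContDiffAt ℝ 1 (fun z => (fderiv ℝ f z).comp (ContinuousLinearMap.inr ℝ E E)) 0 :=
  (hf.fderiv_right (m := 1) (by norm_num)).clm_comp contDiffAt_const

theorem eventually_differentiableAt {f : E × E → E} (hf : ContDiffAt ℝ 2 f 0) :
    ∀ᶠ z in 𝓝 (0 : E × E), DifferentiableAt ℝ f z :=
  (hf.eventually (by simp)).mono fun _ h => h.differentiableAt (by norm_num)

/-- The partial derivative in the second variable vanishes along `(0, w)` and is strictly
differentiable at the origin, so at `(a, w)` it equals `mixedDeriv f a` up to `ε‖a‖`, uniformly in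
`w`. The mean value inequality in the second variable concludes. -/
theorem exists_bilinear_approx {f : E × E → E} (hf : ContDiffAt ℝ 2 f 0)
    (h0 : ∀ᶠ v in 𝓝 (0 : E), f (0, v) = 0) {ε : ℝ} (hε : 0 < ε) :
    ∃ δ > 0, ∀ a b b' : E, ‖a‖ < δ → ‖b‖ < δ → ‖b'‖ < δ →
      ‖f (a, b) - f (a, b') - mixedDeriv f a (b - b')‖ ≤ ε * ‖a‖ * ‖b - b'‖ := by
  set P : E × E → (E →L[ℝ] E) :=
    fun z => (fderiv ℝ f z).comp (ContinuousLinearMap.inr ℝ E E) with hP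
  have hs : HasStrictFDerivAt P (fderiv ℝ P 0) 0 :=
    (contDiffAt_partial hf).hasStrictFDerivAt (by norm_num)
  have h1 := (hasStrictFDerivAt_iff_isLittleO.mp hs).def hε
  rw [Metric.eventually_nhds_iff] at h1
  obtain ⟨δ₁, hδ₁, h1⟩ := h1
  obtain ⟨δ₂, hδ₂, h2⟩ := Metric.eventually_nhds_iff.mp (eventually_differentiableAt hf)
  obtain ⟨δ₃, hδ₃, h3⟩ := Metric.eventually_nhds_iff.mp h0
  have hPw : ∀ w : E, ‖w‖ < min δ₂ δ₃ → P (0, w) = 0 := by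
    intro w hw
    have hd : DifferentiableAt ℝ f (0, w) := h2 (by
      simpa [dist_eq_norm, Prod.norm_def, hδ₂] using lt_of_lt_of_le hw (min_le_left _ _))
    have hcomp : HasFDerivAt (fun v : E => f (0, v)) (P (0, w)) w :=
      hd.hasFDerivAt.comp w (hasFDerivAt_prodMk_right (0 : E) w)
    have hz : HasFDerivAt (fun v : E => f (0, v)) (0 : E →L[ℝ] E) w := by
      refine (hasFDerivAt_const (0 : E) w).congr_of_eventuallyEq ?_
      have : ∀ᶠ v in 𝓝 w, ‖v‖ < δ₃ :=
        (continuous_norm.tendsto w).eventually (gt_mem_nhds (lt_of_lt_of_le hw (min_le_right _ _)))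
      filter_upwards [this] with v hv
      exact h3 (by simpa [dist_eq_norm] using hv)
    exact hcomp.unique hz
  refine ⟨min δ₁ (min δ₂ δ₃), by positivity, fun a b b' ha hb hb' => ?_⟩
  set δ := min δ₁ (min δ₂ δ₃)
  have hder : ∀ w ∈ Metric.ball (0 : E) δ, HasFDerivWithinAt
      (fun w => f (a, w) - mixedDeriv f a w) (P (a, w) - mixedDeriv f a)
      (Metric.ball (0 : E) δ) w := by
    intro w hw
    have hw' : ‖w‖ < δ := by simpa using hw
    have hd : DifferentiableAt ℝ f (a, w) := h2 (by
      simp only [dist_eq_norm, sub_zero, Prod.norm_def, max_lt_iff]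
      exact ⟨lt_of_lt_of_le ha ((min_le_right _ _).trans (min_le_left _ _)),
        lt_of_lt_of_le hw' ((min_le_right _ _).trans (min_le_left _ _))⟩)
    exact ((hd.hasFDerivAt.comp w (hasFDerivAt_prodMk_right a w)).sub
      (mixedDeriv f a).hasFDerivAt).hasFDerivWithinAt
  have hbd : ∀ w ∈ Metric.ball (0 : E) δ, ‖P (a, w) - mixedDeriv f a‖ ≤ ε * ‖a‖ := by
    intro w hw
    have hw' : ‖w‖ < δ := by simpa using hw
    have hd1 : δ ≤ δ₁ := min_le_left _ _
    have := h1 (y := ((a, w), (0, w))) (by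
      simp only [dist_eq_norm, Prod.norm_def, Prod.fst_sub, Prod.snd_sub, sub_zero, max_lt_iff, norm_zero]
      exact ⟨⟨lt_of_lt_of_le ha hd1, lt_of_lt_of_le hw' hd1⟩, hδ₁, lt_of_lt_of_le hw' hd1⟩)
    simp only [hPw w (lt_of_lt_of_le hw' (min_le_right _ _)), sub_zero, Prod.mk_sub_mk,
      sub_self, Prod.norm_def, norm_zero, norm_nonneg, sup_of_le_left] at this
    exact this
  have := (convex_ball (0 : E) δ).norm_image_sub_le_of_norm_hasFDerivWithin_le hder hbd
    (show b' ∈ _ by simpa using hb') (show b ∈ _ by simpa using hb)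
  calc _ = _ := by congr 1; simp only [map_sub]; abel
    _ ≤ _ := this

end Calculus

/-! ### The group law in coordinates -/

/-- Coordinates near the identity of a group, in which multiplication and the commutator are
twice continuously differentiable, and conjugations are differentiable at the identity. -/
structure LocalCoord (E G : Type*) [NormedAddCommGroup E] [NormedSpace ℝ E] [Group G]
    [TopologicalSpace G] where
  coord : G → E
  point : E → G
  coord_one : coord 1 = 0
  continuousAt_coord : ∀ᶠ g in 𝓝 (1 : G), ContinuousAt coord g
  continuousAt_point : ∀ᶠ u in 𝓝 (0 : E), ContinuousAt point u
  point_coord : ∀ᶠ g in 𝓝 (1 : G), point (coord g) = g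
  coord_point : ∀ᶠ u in 𝓝 (0 : E), coord (point u) = u
  contDiffAt_mul : ContDiffAt ℝ 2 (fun z : E × E => coord (point z.1 * point z.2)) 0
  contDiffAt_comm : ContDiffAt ℝ 2 (fun z : E × E => 
    coord (point z.1 * point z.2 * (point z.1)⁻¹ * (point z.2)⁻¹)) 0
  differentiableAt_conj : ∀ g, DifferentiableAt ℝ (fun u => coord (g * point u * g⁻¹)) 0

namespace LocalCoord

variable {E G : Type*} [NormedAddCommGroup E] [NormedSpace ℝ E] [Group G]
    [TopologicalSpace G] (c : LocalCoord E G)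

theorem point_zero : c.point 0 = 1 := by
  have := c.point_coord.self_of_nhds
  rwa [c.coord_one] at this

theorem tendsto_coord : Tendsto c.coord (𝓝 1) (𝓝 0) := by
  have := c.continuousAt_coord.self_of_nhds
  rwa [ContinuousAt, c.coord_one] at this

theorem tendsto_point : Tendsto c.point (𝓝 0) (𝓝 1) := by
  have := c.continuousAt_point.self_of_nhds
  rwa [ContinuousAt, c.point_zero] at this

/-- Multiplication in coordinates. -/
def mulC (u v : E) : E := c.coord (c.point u * c.point v)

/-- The commutator in coordinates. -/
def commC (u v : E) : E := c.coord (c.point u * c.point v * (c.point u)⁻¹ * (c.point v)⁻¹)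

theorem mulC_zero_left : ∀ᶠ v in 𝓝 (0 : E), c.mulC 0 v = v := by
  filter_upwards [c.coord_point] with v hv
  simp [mulC, c.point_zero, hv]

theorem mulC_zero_right : ∀ᶠ v in 𝓝 (0 : E), c.mulC v 0 = v := by
  filter_upwards [c.coord_point] with v hv
  simp [mulC, c.point_zero, hv]

theorem hasStrictFDerivAt_mulC : HasStrictFDerivAt (fun z : E × E => c.mulC z.1 z.2)
    (ContinuousLinearMap.fst ℝ E E + ContinuousLinearMap.snd ℝ E E) 0 := by
  obtain ⟨L, h⟩ : ∃ L, HasStrictFDerivAt (fun z : E × E => c.mulC z.1 z.2) L 0 :=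
    ⟨_, c.contDiffAt_mul.hasStrictFDerivAt (by norm_num)⟩
  have h1 : HasFDerivAt (fun v : E => c.mulC v 0) (L.comp (ContinuousLinearMap.inl ℝ E E)) 0 :=
    HasFDerivAt.comp (g := fun z : E × E => c.mulC z.1 z.2) (f := fun v : E => (v, (0 : E)))
      (0 : E) h.hasFDerivAt (hasFDerivAt_prodMk_left (0 : E) (0 : E))
  have h2 : HasFDerivAt (fun v : E => c.mulC 0 v) (L.comp (ContinuousLinearMap.inr ℝ E E)) 0 :=
    HasFDerivAt.comp (g := fun z : E × E => c.mulC z.1 z.2) (0 : E) h.hasFDerivAt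
      (hasFDerivAt_prodMk_right (0 : E) (0 : E))
  have e1 := h1.unique ((hasFDerivAt_id (0 : E)).congr_of_eventuallyEq c.mulC_zero_right)
  have e2 := h2.unique ((hasFDerivAt_id (0 : E)).congr_of_eventuallyEq c.mulC_zero_left)
  have : ContinuousLinearMap.fst ℝ E E + ContinuousLinearMap.snd ℝ E E = L := by
    refine ContinuousLinearMap.ext fun z => ?_
    have a1 := DFunLike.congr_fun e1 z.1
    have a2 := DFunLike.congr_fun e2 z.2
    simp only [ContinuousLinearMap.comp_apply, ContinuousLinearMap.inl_apply,
      ContinuousLinearMap.inr_apply, ContinuousLinearMap.id_apply] at a1 a2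
    have : L z = L (z.1, 0) + L (0, z.2) := by rw [← map_add]; simp
    rw [this, a1, a2]
    simp
  rwa [this]

theorem eventually_point_mulC [IsTopologicalGroup G] :
    ∀ᶠ z : E × E in 𝓝 0, c.point z.1 * c.point z.2 = c.point (c.mulC z.1 z.2) := by
  have ht : Tendsto (fun z : E × E => c.point z.1 * c.point z.2) (𝓝 0) (𝓝 1) := by
    have h1 : Tendsto (fun z : E × E => z.1) (𝓝 0) (𝓝 0) := continuous_fst.tendsto' _ _ rfl
    have h2 : Tendsto (fun z : E × E => z.2) (𝓝 0) (𝓝 0) := continuous_snd.tendsto' _ _ rfl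
    simpa using (c.tendsto_point.comp h1).mul (c.tendsto_point.comp h2)
  filter_upwards [ht.eventually c.point_coord] with z hz
  exact hz.symm

/-- Quantitative form of the group law near the identity. -/
theorem exists_law [IsTopologicalGroup G] : ∃ ρ > 0, ∃ C > 0, ∀ u v : E, ‖u‖ < ρ → ‖v‖ < ρ →
    (ContinuousAt c.point u ∧ c.coord (c.point u) = u ∧
      c.point u * c.point v = c.point (c.mulC u v)) ∧
    ‖c.mulC u v - u - v‖ ≤ C * ‖u‖ * ‖v‖ ∧
    (∀ w, ‖w‖ < ρ → ‖c.mulC u v - c.mulC u w - (v - w)‖ ≤ C * ‖u‖ * ‖v - w‖) ∧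
    (∀ w, ‖w‖ < ρ → ‖c.mulC u v - c.mulC w v‖ ≤ 2 * ‖u - w‖) := by
  -- Removing `u + v` leaves a function that vanishes for `u = 0`, so its increments in `v` carry a
  -- factor `‖u‖`.
  set f : E × E → E := fun z => c.mulC z.1 z.2 - z.1 - z.2 with hf
  have hfc : ContDiffAt ℝ 2 f 0 :=
    (c.contDiffAt_mul.sub contDiffAt_fst).sub contDiffAt_snd
  have hf0 : ∀ᶠ v in 𝓝 (0 : E), f (0, v) = 0 := by
    filter_upwards [c.mulC_zero_left] with v hv
    simp [hf, hv]
  obtain ⟨δ, hδ, hb⟩ := exists_bilinear_approx hfc hf0 one_pos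
  have hst := (hasStrictFDerivAt_iff_isLittleO.mp c.hasStrictFDerivAt_mulC).def one_pos
  obtain ⟨δ₁, hδ₁, h1⟩ := Metric.eventually_nhds_iff.mp hst
  obtain ⟨δ₂, hδ₂, h2⟩ := Metric.eventually_nhds_iff.mp c.eventually_point_mulC
  obtain ⟨δ₃, hδ₃, h3⟩ := Metric.eventually_nhds_iff.mp
    (c.continuousAt_point.and (c.coord_point.and c.mulC_zero_right))
  set C := ‖mixedDeriv f‖ + 1 with hC
  have hlip : ∀ u v w : E, ‖u‖ < δ → ‖v‖ < δ → ‖w‖ < δ →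
      ‖c.mulC u v - c.mulC u w - (v - w)‖ ≤ C * ‖u‖ * ‖v - w‖ := by
    intro u v w hu hv hw
    have h := hb u v w hu hv hw
    have h' : ‖mixedDeriv f u (v - w)‖ ≤ ‖mixedDeriv f‖ * ‖u‖ * ‖v - w‖ :=
      ContinuousLinearMap.le_opNorm₂ _ _ _
    have e : c.mulC u v - c.mulC u w - (v - w) =
        (f (u, v) - f (u, w) - mixedDeriv f u (v - w)) + mixedDeriv f u (v - w) := by
      simp only [hf]; abel
    rw [e]
    refine (norm_add_le _ _).trans ?_
    rw [hC]
    linarith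
  refine ⟨min δ (min δ₁ (min δ₂ δ₃)), by positivity, C, by positivity, fun u v hu hv => ?_⟩
  simp only [lt_min_iff] at hu hv
  refine ⟨⟨?_, ?_, ?_⟩, ?_, ?_, ?_⟩
  · exact (h3 (by simpa using hu.2.2.2)).1
  · exact (h3 (by simpa using hu.2.2.2)).2.1
  · exact h2 (y := (u, v)) (by simpa [Prod.norm_def] using ⟨hu.2.2.1, hv.2.2.1⟩)
  · have := hlip u v 0 hu.1 hv.1 (by simpa using hδ)
    rwa [(h3 (by simpa using hu.2.2.2)).2.2, sub_zero] at this
  · intro w hw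
    simp only [lt_min_iff] at hw
    exact hlip u v w hu.1 hv.1 hw.1
  · intro w hw
    simp only [lt_min_iff] at hw
    have := h1 (y := ((u, v), (w, v))) (by
      simp [Prod.norm_def, dist_eq_norm, hu, hv, hw])
    simp only [Prod.mk_sub_mk, sub_self, add_apply, ContinuousLinearMap.coe_fst',
      ContinuousLinearMap.coe_snd', Prod.norm_def, norm_zero, norm_nonneg, sup_of_le_left,
      add_zero, one_mul] at this
    calc _ = ‖(c.mulC u v - c.mulC w v - (u - w)) + (u - w)‖ := by congr 1; abel
      _ ≤ _ := norm_add_le _ _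
      _ ≤ _ := by linarith

end LocalCoord
-- Powers of small elements; uniqueness of one-parameter subgroups
namespace LocalCoord

variable {E G : Type*} [NormedAddCommGroup E] [NormedSpace ℝ E] [Group G]
    [TopologicalSpace G] (c : LocalCoord E G)

/-- Replaces the theory of differential equations: the power `k` of a small element has coordinates
`k • u` up to a quadratic error, with Lipschitz constant of order `k`, and all constants are
independent of `k`. -/
theorem exists_pow_bound [IsTopologicalGroup G] : ∃ r > 0, ∃ C > 0,
    (∀ u, ‖u‖ ≤ 2 * r → ContinuousAt c.point u ∧ c.coord (c.point u) = u) ∧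
    (∀ (k : ℕ) (u : E), k * ‖u‖ ≤ r → ‖u‖ ≤ r →
      c.point u ^ k = c.point (c.coord (c.point u ^ k)) ∧
      ‖c.coord (c.point u ^ k)‖ ≤ 2 * r ∧
      ‖c.coord (c.point u ^ k) - (k : ℝ) • u‖ ≤ C * (k * ‖u‖) ^ 2) ∧
    (∀ (k : ℕ) (u v : E), k * ‖u‖ ≤ r → ‖u‖ ≤ r → k * ‖v‖ ≤ r → ‖v‖ ≤ r →
      ‖c.coord (c.point u ^ k) - c.coord (c.point v ^ k)‖ ≤ C * k * ‖u - v‖) := by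
  obtain ⟨ρ, hρ, C, hC, H⟩ := c.exists_law
  -- With `r ≤ 1 / C` the quadratic error `C q ^ 2` is at most `q`, where `q = k‖u‖ ≤ r`. Hence all
  -- powers have coordinates of norm at most `2 * r < ρ`, and the group law estimates stay available
  -- during the induction.
  set r := min (ρ / 4) (1 / C) with hr
  have hr0 : 0 < r := by positivity
  have hrρ : 2 * r < ρ := by have : r ≤ ρ / 4 := min_le_left _ _; linarith
  have hrC : C * r ≤ 1 := by
    have : r ≤ 1 / C := min_le_right _ _
    calc C * r ≤ C * (1 / C) := by gcongr
      _ = 1 := by field_simp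
  have key : ∀ (k : ℕ) (u : E), k * ‖u‖ ≤ r → ‖u‖ ≤ r →
      c.point u ^ k = c.point (c.coord (c.point u ^ k)) ∧
      ‖c.coord (c.point u ^ k)‖ ≤ 2 * (k * ‖u‖) ∧
      ‖c.coord (c.point u ^ k) - (k : ℝ) • u‖ ≤ C * (k * ‖u‖) ^ 2 := by
    intro k u hk hu
    induction k with
    | zero => simp [c.coord_one, c.point_zero]
    | succ k ih =>
      have hk' : (k : ℝ) * ‖u‖ ≤ r := le_trans (by gcongr; simp) hk
      obtain ⟨h1, h2, h3⟩ := ih hk'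
      set W := c.coord (c.point u ^ k) with hW
      have hWρ : ‖W‖ < ρ := by linarith
      have huρ : ‖u‖ < ρ := by linarith
      obtain ⟨⟨-, -, hm⟩, hb, -, -⟩ := H u W huρ hWρ
      have e : c.point u ^ (k + 1) = c.point (c.mulC u W) := by
        rw [pow_succ', h1, hm]
      have e2 : c.coord (c.point u ^ (k + 1)) = c.mulC u W := by
        rw [pow_succ', h1, mulC]
      rw [e2]
      have hb3 : ‖c.mulC u W - ((k + 1 : ℕ) : ℝ) • u‖ ≤ C * (((k + 1 : ℕ) : ℝ) * ‖u‖) ^ 2 := by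
        calc _ = ‖(c.mulC u W - u - W) + (W - (k : ℝ) • u)‖ := by
              congr 1; push_cast; rw [add_smul, one_smul]; abel
          _ ≤ C * ‖u‖ * ‖W‖ + C * (k * ‖u‖) ^ 2 := (norm_add_le _ _).trans (add_le_add hb h3)
          _ ≤ C * ‖u‖ * (2 * (k * ‖u‖)) + C * (k * ‖u‖) ^ 2 := by gcongr
          _ ≤ _ := by push_cast; nlinarith [sq_nonneg ‖u‖]
      refine ⟨e, ?_, hb3⟩
      set q := ((k + 1 : ℕ) : ℝ) * ‖u‖ with hq
      have hq0 : 0 ≤ q := by positivity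
      calc ‖c.mulC u W‖ = ‖(c.mulC u W - ((k + 1 : ℕ) : ℝ) • u) + ((k + 1 : ℕ) : ℝ) • u‖ := by
            congr 1; abel
        _ ≤ C * q ^ 2 + q := by
            refine (norm_add_le _ _).trans (add_le_add hb3 ?_)
            rw [norm_smul, Real.norm_natCast]
        _ ≤ 2 * q := by
            have : C * q ≤ 1 := le_trans (by gcongr) hrC
            nlinarith
  refine ⟨r, hr0, C + 2 * Real.exp 1, by positivity, ?_, ?_, ?_⟩
  · intro u hu
    have := (H u u (by linarith) (by linarith)).1
    exact ⟨this.1, this.2.1⟩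
  · intro k u hk hu
    obtain ⟨h1, h2, h3⟩ := key k u hk hu
    refine ⟨h1, by linarith, h3.trans ?_⟩
    have : 0 < Real.exp 1 := Real.exp_pos 1
    gcongr
    linarith
  · intro k u v hku hu hkv hv
    -- One more factor multiplies the discrepancy by at most `1 + C‖u‖ ≤ exp (C‖u‖)` and adds `2‖u -
    -- v‖`; the accumulated exponential is at most `e` since `C * r ≤ 1`.
    have hlip : ‖c.coord (c.point u ^ k) - c.coord (c.point v ^ k)‖ ≤
        2 * k * Real.exp (C * (k * ‖u‖)) * ‖u - v‖ := by
      induction k with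
      | zero => simp
      | succ k ih =>
        have hk' : (k : ℝ) * ‖u‖ ≤ r := le_trans (by gcongr; simp) hku
        have hl' : (k : ℝ) * ‖v‖ ≤ r := le_trans (by gcongr; simp) hkv
        have ih := ih hk' hl'
        obtain ⟨a1, a2, -⟩ := key k u hk' hu
        obtain ⟨b1, b2, -⟩ := key k v hl' hv
        have e1 : c.coord (c.point u ^ (k + 1)) = c.mulC u (c.coord (c.point u ^ k)) := by
          rw [pow_succ', mulC, ← a1]
        have e2 : c.coord (c.point v ^ (k + 1)) = c.mulC v (c.coord (c.point v ^ k)) := by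
          rw [pow_succ', mulC, ← b1]
        rw [e1, e2]
        set U := c.coord (c.point u ^ k)
        set V := c.coord (c.point v ^ k)
        have hU : ‖U‖ < ρ := by linarith
        have hV : ‖V‖ < ρ := by linarith
        have h1 := (H u U (by linarith) hU).2.2.1 V hV
        have h2 := (H u V (by linarith) hV).2.2.2 v (by linarith)
        have h3 : ‖c.mulC u U - c.mulC u V‖ ≤ (1 + C * ‖u‖) * ‖U - V‖ := by
          calc _ = ‖(c.mulC u U - c.mulC u V - (U - V)) + (U - V)‖ := by congr 1; abel
            _ ≤ _ := norm_add_le _ _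
            _ ≤ _ := by linarith
        have hexp : 1 + C * ‖u‖ ≤ Real.exp (C * ‖u‖) := by
          rw [add_comm]; exact Real.add_one_le_exp _
        have hone : 1 ≤ Real.exp (C * ((k + 1 : ℕ) * ‖u‖)) := Real.one_le_exp (by positivity)
        calc _ = ‖(c.mulC u U - c.mulC u V) + (c.mulC u V - c.mulC v V)‖ := by congr 1; abel
          _ ≤ _ := norm_add_le _ _
          _ ≤ Real.exp (C * ‖u‖) * (2 * k * Real.exp (C * (k * ‖u‖)) * ‖u - v‖)
              + 2 * ‖u - v‖ := by
            refine add_le_add (h3.trans ?_) h2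
            gcongr
          _ = 2 * k * Real.exp (C * ((k + 1 : ℕ) * ‖u‖)) * ‖u - v‖ + 2 * 1 * ‖u - v‖ := by
            have : Real.exp (C * ((k + 1 : ℕ) * ‖u‖)) =
                Real.exp (C * ‖u‖) * Real.exp (C * (k * ‖u‖)) := by
              rw [← Real.exp_add]; congr 1; push_cast; ring
            rw [this]; ring
          _ ≤ 2 * k * Real.exp (C * ((k + 1 : ℕ) * ‖u‖)) * ‖u - v‖
              + 2 * Real.exp (C * ((k + 1 : ℕ) * ‖u‖)) * ‖u - v‖ := by gcongr
          _ = _ := by push_cast; ring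
    refine hlip.trans ?_
    have : C * (k * ‖u‖) ≤ 1 := le_trans (by gcongr) hrC
    have h2 : Real.exp (C * (k * ‖u‖)) ≤ Real.exp 1 := Real.exp_le_exp.mpr this
    calc _ ≤ 2 * k * Real.exp 1 * ‖u - v‖ := by gcongr
      _ = 2 * Real.exp 1 * k * ‖u - v‖ := by ring
      _ ≤ _ := by gcongr; linarith

/-- `γ` is a one-parameter subgroup with velocity `X` at the identity. -/
structure IsOneParam (γ : ℝ → G) (X : E) : Prop where
  map_add : ∀ s t, γ (s + t) = γ s * γ t
  tendsto : Tendsto γ (𝓝 0) (𝓝 1)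
  hasDerivAt : HasDerivAt (fun t => c.coord (γ t)) X 0

namespace IsOneParam

variable {c} {γ η : ℝ → G} {X Y : E}

theorem map_zero (h : c.IsOneParam γ X) : γ 0 = 1 := by
  have := h.map_add 0 0
  simpa using this

theorem map_neg (h : c.IsOneParam γ X) (t : ℝ) : γ (-t) = (γ t)⁻¹ := by
  rw [eq_inv_iff_mul_eq_one, ← h.map_add, neg_add_cancel, h.map_zero]

theorem map_nsmul (h : c.IsOneParam γ X) (k : ℕ) (t : ℝ) : γ (k * t) = γ t ^ k := by
  induction k with
  | zero => simp [h.map_zero]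
  | succ k ih => rw [Nat.cast_succ, add_mul, one_mul, h.map_add, ih, pow_succ]

theorem map_div_pow (h : c.IsOneParam γ X) (k : ℕ) (t : ℝ) :
    γ (t / (k + 1)) ^ (k + 1) = γ t := by
  rw [← h.map_nsmul]
  congr 1
  push_cast
  field_simp

theorem commute (h : c.IsOneParam γ X) (s t : ℝ) : γ s * γ t = γ t * γ s := by
  rw [← h.map_add, ← h.map_add, add_comm]

theorem continuous [IsTopologicalGroup G] (h : c.IsOneParam γ X) : Continuous γ := by
  rw [continuous_iff_continuousAt]
  intro t
  have h1 : Tendsto (fun s => γ t * γ (s - t)) (𝓝 t) (𝓝 (γ t * 1)) := by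
    refine tendsto_const_nhds.mul (h.tendsto.comp ?_)
    exact (continuous_sub_right t).tendsto' _ _ (by simp)
  rw [mul_one] at h1
  refine h1.congr fun s => ?_
  rw [← h.map_add]; congr 1; ring

theorem comp_mul (h : c.IsOneParam γ X) (a : ℝ) : c.IsOneParam (fun t => γ (a * t)) (a • X) where
  map_add s t := by rw [mul_add, h.map_add]
  tendsto := h.tendsto.comp ((continuous_const_mul a).tendsto' _ _ (by simp))
  hasDerivAt := by
    have h2 : HasDerivAt (fun t : ℝ => a * t) a 0 := by
      simpa using (hasDerivAt_id (0 : ℝ)).const_mul a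
    exact HasDerivAt.scomp_of_eq (0 : ℝ) h.hasDerivAt h2 (by simp)

theorem tendsto_div (t : ℝ) :
    Tendsto (fun k : ℕ => t / ((k : ℝ) + 1)) atTop (𝓝 0) :=
  tendsto_const_nhds.div_atTop (tendsto_atTop_add_const_right _ _ tendsto_natCast_atTop_atTop)

theorem tendsto_smul_coord (h : c.IsOneParam γ X) (t : ℝ) :
    Tendsto (fun k : ℕ => ((k : ℝ) + 1) • c.coord (γ (t / (k + 1)))) atTop (𝓝 (t • X)) := by
  have h0 : Tendsto (fun k : ℕ => 1 / ((k : ℝ) + 1)) atTop (𝓝[≠] 0) := by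
    refine tendsto_nhdsWithin_iff.mpr ⟨tendsto_div 1, Eventually.of_forall fun k => ?_⟩
    simp only [Set.mem_compl_iff, Set.mem_singleton_iff]
    positivity
  refine ((h.comp_mul t).hasDerivAt.tendsto_slope_zero.comp h0).congr fun k => ?_
  simp [h.map_zero, c.coord_one, div_eq_mul_inv]

theorem eventually_point (h : c.IsOneParam γ X) (t : ℝ) :
    ∀ᶠ k : ℕ in atTop, c.point (c.coord (γ (t / (k + 1)))) = γ (t / (k + 1)) :=
  (h.tendsto.comp (tendsto_div t)).eventually c.point_coord

theorem eventually_small (h : c.IsOneParam γ X) (t : ℝ) {r : ℝ} (hr : 0 < r)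
    (ht : |t| * ‖X‖ < r) : ∀ᶠ k : ℕ in atTop,
      ((k + 1 : ℕ) : ℝ) * ‖c.coord (γ (t / (k + 1)))‖ ≤ r ∧ ‖c.coord (γ (t / (k + 1)))‖ ≤ r := by
  have h1 := (h.tendsto_smul_coord t).norm
  rw [norm_smul, Real.norm_eq_abs] at h1
  have h2 := (c.tendsto_coord.comp (h.tendsto.comp (tendsto_div t))).norm
  rw [norm_zero] at h2
  filter_upwards [h1.eventually (ge_mem_nhds ht), h2.eventually (ge_mem_nhds hr)] with k a b
  refine ⟨?_, b⟩
  rw [norm_smul, Real.norm_of_nonneg (by positivity)] at a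
  exact_mod_cast a

end IsOneParam

/-- Write `γ t` as the power `k + 1` of `γ (t / (k + 1))`, use the power estimate and let `k` tend
to infinity. The constants do not depend on `γ`, which later gives continuity of the exponential map
at `0`. -/
theorem exists_oneParam_bound [IsTopologicalGroup G] : ∃ r > 0, ∃ C > 0,
    ∀ (γ : ℝ → G) (X : E) (t : ℝ), c.IsOneParam γ X → |t| * ‖X‖ < r →
      γ t = c.point (c.coord (γ t)) ∧ ‖c.coord (γ t) - t • X‖ ≤ C * (|t| * ‖X‖) ^ 2 := by
  obtain ⟨r, hr, C, hC, -, H, -⟩ := c.exists_pow_bound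
  refine ⟨r, hr, C, hC, fun γ X t h ht => ?_⟩
  have hev := (h.eventually_point t).and (h.eventually_small t hr ht)
  constructor
  · obtain ⟨k, e, a, b⟩ := hev.exists
    have := (H (k + 1) _ a b).1
    rwa [e, h.map_div_pow] at this
  · have h1 := h.tendsto_smul_coord t
    have h2 : Tendsto (fun k : ℕ => C * (((k + 1 : ℕ) : ℝ) * ‖c.coord (γ (t / (k + 1)))‖) ^ 2)
        atTop (𝓝 (C * (|t| * ‖X‖) ^ 2)) := by
      have := ((h1.norm).pow 2).const_mul C
      rw [norm_smul, Real.norm_eq_abs] at this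
      refine this.congr fun k => ?_
      rw [norm_smul, Real.norm_of_nonneg (by positivity)]
      push_cast; rfl
    refine le_of_tendsto_of_tendsto ((tendsto_const_nhds.sub h1).norm) h2 ?_
    filter_upwards [hev] with k hk
    obtain ⟨e, a, b⟩ := hk
    have := (H (k + 1) _ a b).2.2
    rw [e, h.map_div_pow] at this
    push_cast at this ⊢
    exact this

/-- The coordinates of `γ (t / (k + 1))` and `η (t / (k + 1))` differ by `o(1 / k)`, and taking
powers multiplies the difference by `O(k)`; so `γ` and `η` agree for small `t`, hence everywhere by
taking powers. -/
theorem IsOneParam.eq [IsTopologicalGroup G] {c : LocalCoord E G} {γ η : ℝ → G} {X : E}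
    (h : c.IsOneParam γ X) (h' : c.IsOneParam η X) : γ = η := by
  obtain ⟨r, hr, C, hC, -, H, HL⟩ := c.exists_pow_bound
  have small : ∀ t : ℝ, |t| * ‖X‖ < r → γ t = η t := by
    intro t ht
    have hev := ((h.eventually_point t).and (h.eventually_small t hr ht)).and
      ((h'.eventually_point t).and (h'.eventually_small t hr ht))
    have hz : c.coord (γ t) = c.coord (η t) := by
      rw [← sub_eq_zero, ← norm_le_zero_iff]
      have h1 := (((h.tendsto_smul_coord t).sub (h'.tendsto_smul_coord t)).norm).const_mul C
      rw [sub_self, norm_zero, mul_zero] at h1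
      refine le_of_tendsto_of_tendsto tendsto_const_nhds h1 ?_
      filter_upwards [hev] with k hk
      obtain ⟨⟨e, a, b⟩, e', a', b'⟩ := hk
      have := HL (k + 1) _ _ a b a' b'
      rw [e, e', h.map_div_pow, h'.map_div_pow] at this
      rw [← smul_sub, norm_smul, Real.norm_of_nonneg (by positivity), ← mul_assoc]
      exact_mod_cast this
    obtain ⟨k, ⟨e, a, b⟩, e', a', b'⟩ := hev.exists
    have h1 := (H (k + 1) _ a b).1
    have h2 := (H (k + 1) _ a' b').1
    rw [e, h.map_div_pow] at h1
    rw [e', h'.map_div_pow] at h2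
    rw [h1, h2, hz]
  funext t
  have : Tendsto (fun k : ℕ => |t / ((k : ℝ) + 1)| * ‖X‖) atTop (𝓝 0) := by
    simpa using ((tendsto_div t).abs).mul_const ‖X‖
  obtain ⟨k, hk⟩ := (this.eventually (gt_mem_nhds hr)).exists
  rw [← h.map_div_pow k t, ← h'.map_div_pow k t, small _ hk]

end LocalCoord
-- Existence of one-parameter subgroups by compactness
namespace LocalCoord

variable {E G : Type*} [NormedAddCommGroup E] [NormedSpace ℝ E] [Group G]
    [TopologicalSpace G] (c : LocalCoord E G)

/-- Inversion in coordinates. -/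
def invC (u : E) : E := c.coord (c.point u)⁻¹

theorem tendsto_point_inv [IsTopologicalGroup G] :
    Tendsto (fun u => (c.point u)⁻¹) (𝓝 0) (𝓝 1) := by
  simpa using c.tendsto_point.inv

theorem eventually_point_invC [IsTopologicalGroup G] :
    ∀ᶠ u in 𝓝 (0 : E), (c.point u)⁻¹ = c.point (c.invC u) :=
  (c.tendsto_point_inv.eventually c.point_coord).mono fun _ h => h.symm

theorem tendsto_invC [IsTopologicalGroup G] : Tendsto c.invC (𝓝 0) (𝓝 0) :=
  c.tendsto_coord.comp c.tendsto_point_inv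

/-- The group law estimate is applied to the product of an element and its inverse, whose coordinate
is `0`. This yields the derivative of inversion, which is not among the fields of `LocalCoord`. -/
theorem exists_invC_bound [IsTopologicalGroup G] :
    ∃ C > 0, ∀ᶠ u in 𝓝 (0 : E), ‖c.invC u + u‖ ≤ C * ‖u‖ ^ 2 := by
  obtain ⟨ρ, hρ, C, hC, H⟩ := c.exists_law
  have hn : ∀ {a : ℝ}, 0 < a → ∀ᶠ u in 𝓝 (0 : E), ‖u‖ < a := fun {a} ha =>
    (continuous_norm.tendsto' (0 : E) 0 norm_zero).eventually (gt_mem_nhds ha)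
  refine ⟨2 * C, by positivity, ?_⟩
  filter_upwards [hn hρ, hn (show 0 < 1 / (2 * C) by positivity), c.tendsto_invC.eventually (hn hρ),
    c.eventually_point_invC] with u h1 h2 h3 h4
  have hb := (H u (c.invC u) h1 h3).2.1
  have hz : c.mulC u (c.invC u) = 0 := by rw [mulC, ← h4, mul_inv_cancel, c.coord_one]
  rw [hz, show (0 : E) - u - c.invC u = -(c.invC u + u) by abel, norm_neg] at hb
  have h5 : C * ‖u‖ ≤ 1 / 2 := by
    calc C * ‖u‖ ≤ C * (1 / (2 * C)) := by gcongr
      _ = 1 / 2 := by field_simp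
  have h6 : ‖c.invC u‖ ≤ 2 * ‖u‖ := by
    have : ‖c.invC u‖ ≤ ‖c.invC u + u‖ + ‖u‖ := by
      simpa using norm_sub_le (c.invC u + u) u
    nlinarith [norm_nonneg (c.invC u)]
  calc _ ≤ C * ‖u‖ * ‖c.invC u‖ := hb
    _ ≤ C * ‖u‖ * (2 * ‖u‖) := by gcongr
    _ = _ := by ring

theorem hasFDerivAt_invC [IsTopologicalGroup G] :
    HasFDerivAt c.invC (-ContinuousLinearMap.id ℝ E) 0 := by
  obtain ⟨C, -, h⟩ := c.exists_invC_bound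
  have h1 : (fun u => c.invC u + u) =O[𝓝 (0 : E)] fun u => ‖u - 0‖ ^ 2 := by
    refine Asymptotics.IsBigO.of_bound C (h.mono fun u hu => ?_)
    simpa using hu
  have := (h1.hasFDerivAt (𝕜 := ℝ) one_lt_two).sub (hasFDerivAt_id (0 : E))
  rw [zero_sub] at this
  exact this.congr_of_eventuallyEq (Eventually.of_forall fun u => by simp)

theorem tendsto_floor_mul {δ : ℕ → ℝ} (hδ : ∀ n, 0 < δ n) (hδ0 : Tendsto δ atTop (𝓝 0)) {t : ℝ}
    (ht : 0 ≤ t) : Tendsto (fun n => (⌊t / δ n⌋₊ : ℝ) * δ n) atTop (𝓝 t) := by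
  refine tendsto_of_tendsto_of_tendsto_of_le_of_le (g := fun n => t - δ n) (h := fun _ => t) ?_
    tendsto_const_nhds (fun n => ?_) fun n => ?_
  · simpa using tendsto_const_nhds.sub hδ0
  · have := (Nat.lt_floor_add_one (t / δ n)).le
    rw [div_le_iff₀ (hδ n)] at this
    show t - δ n ≤ _
    linarith
  · have := Nat.floor_le (div_nonneg ht (hδ n).le)
    rwa [le_div_iff₀ (hδ n)] at this

/-- Limits of powers of small elements of a closed subgroup of a compact group form a
one-parameter subgroup. -/
theorem exists_oneParam_of_tendsto [IsTopologicalGroup G] [T2Space G] [CompactSpace G]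
    [FiniteDimensional ℝ E] {A : Subgroup G} (hA : IsClosed (A : Set G)) {u : ℕ → E} {δ : ℕ → ℝ}
    {X : E} (hδ : ∀ n, 0 < δ n) (hδ0 : Tendsto δ atTop (𝓝 0))
    (hu : Tendsto (fun n => (δ n)⁻¹ • u n) atTop (𝓝 X)) (huA : ∀ n, c.point (u n) ∈ A) :
    ∃ γ : ℝ → G, c.IsOneParam γ X ∧ ∀ t, γ t ∈ A := by
  obtain ⟨r, hr, C, hC, Hr, H, -⟩ := c.exists_pow_bound
  have : ProperSpace E := FiniteDimensional.proper ℝ E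
  -- Along an ultrafilter, compactness of `G` makes the powers with exponent `⌊t / δ n⌋` converge
  -- for all `t` at once, without extracting subsequences.
  set 𝒰 : Ultrafilter ℕ := hyperfilter ℕ
  have h𝒰 : (𝒰 : Filter ℕ) ≤ atTop := Nat.hyperfilter_le_atTop
  have hu0 : Tendsto u atTop (𝓝 0) := by
    have := hδ0.smul hu
    rw [zero_smul] at this
    refine this.congr fun n => ?_
    rw [smul_inv_smul₀ (hδ n).ne']
  have hg1 : Tendsto (fun n => c.point (u n)) 𝒰 (𝓝 1) := (c.tendsto_point.comp hu0).mono_left h𝒰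
  have hex : ∀ t : ℝ, ∃ x : G, Tendsto (fun n => c.point (u n) ^ ⌊t / δ n⌋) 𝒰 (𝓝 x) := fun t =>
    ⟨_, (𝒰.map fun n => c.point (u n) ^ ⌊t / δ n⌋).le_nhds_lim⟩
  choose γ hγ using hex
  have hadd : ∀ s t, γ (s + t) = γ s * γ t := by
    intro s t
    -- The floor is additive up to `0` or `1`, and a single factor `c.point (u n)` tends to `1`.
    have key : Tendsto (fun n => c.point (u n) ^ (⌊(s + t) / δ n⌋ - ⌊s / δ n⌋ - ⌊t / δ n⌋))
        𝒰 (𝓝 1) := by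
      intro U hU
      change ∀ᶠ n in (𝒰 : Filter ℕ), _
      filter_upwards [hg1.eventually_mem hU] with n hn
      have h1 := Int.le_floor_add (s / δ n) (t / δ n)
      have h2 := Int.le_floor_add_floor (s / δ n) (t / δ n)
      rw [← add_div] at h1 h2
      have : ⌊(s + t) / δ n⌋ - ⌊s / δ n⌋ - ⌊t / δ n⌋ = 0 ∨
        ⌊(s + t) / δ n⌋ - ⌊s / δ n⌋ - ⌊t / δ n⌋ = 1 := by omega
      rcases this with h | h
      · simpa [h] using mem_of_mem_nhds hU
      · simpa [h] using hn
    have h := key.mul ((hγ s).mul (hγ t))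
    rw [one_mul] at h
    refine tendsto_nhds_unique (hγ (s + t)) (h.congr fun n => ?_)
    rw [← zpow_add, ← zpow_add]
    congr 1
    ring
  have hmem : ∀ t, γ t ∈ A := fun t =>
    hA.mem_of_tendsto (hγ t) (Eventually.of_forall fun n => A.zpow_mem (huA n) _)
  have hpos : ∀ t, 0 ≤ t → t * ‖X‖ < r → γ t = c.point (c.coord (γ t)) ∧
      ‖c.coord (γ t)‖ ≤ 2 * r ∧ ‖c.coord (γ t) - t • X‖ ≤ C * (t * ‖X‖) ^ 2 := by
    intro t ht htr
    set k : ℕ → ℕ := fun n => ⌊t / δ n⌋₊ with hk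
    have hku : Tendsto (fun n => (k n : ℝ) • u n) atTop (𝓝 (t • X)) := by
      refine ((tendsto_floor_mul hδ hδ0 ht).smul hu).congr fun n => ?_
      rw [mul_smul, smul_inv_smul₀ (hδ n).ne']
    have hkn : Tendsto (fun n => (k n : ℝ) * ‖u n‖) atTop (𝓝 (t * ‖X‖)) := by
      have := hku.norm
      rw [norm_smul, Real.norm_of_nonneg ht] at this
      exact this.congr fun n => by rw [norm_smul, Real.norm_natCast]
    have hun : Tendsto (fun n => ‖u n‖) atTop (𝓝 0) := by simpa using hu0.norm
    have hev : ∀ᶠ n in (𝒰 : Filter ℕ), (k n : ℝ) * ‖u n‖ ≤ r ∧ ‖u n‖ ≤ r :=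
      h𝒰 ((hkn.eventually (ge_mem_nhds htr)).and (hun.eventually (ge_mem_nhds hr)))
    have hγ' : Tendsto (fun n => c.point (u n) ^ k n) 𝒰 (𝓝 (γ t)) := by
      refine (hγ t).congr fun n => ?_
      rw [← zpow_natCast, hk]
      simp only
      rw [Int.natCast_floor_eq_floor (div_nonneg ht (hδ n).le)]
    obtain ⟨w, hw, hlim⟩ := (isCompact_closedBall (0 : E) (2 * r)).ultrafilter_le_nhds
      (𝒰.map fun n => c.coord (c.point (u n) ^ k n)) (by
        rw [le_principal_iff]
        change ∀ᶠ n in (𝒰 : Filter ℕ), _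
        filter_upwards [hev] with n hn
        simpa using (H (k n) (u n) hn.1 hn.2).2.1)
    have hwr : ‖w‖ ≤ 2 * r := by simpa using hw
    have hlim' : Tendsto (fun n => c.coord (c.point (u n) ^ k n)) 𝒰 (𝓝 w) := hlim
    have hγw : γ t = c.point w := by
      refine tendsto_nhds_unique hγ' (((Hr w hwr).1.tendsto.comp hlim').congr' ?_)
      filter_upwards [hev] with n hn
      exact (H (k n) (u n) hn.1 hn.2).1.symm
    have hcw : c.coord (γ t) = w := by rw [hγw, (Hr w hwr).2]
    rw [hcw]
    refine ⟨hγw, hwr, ?_⟩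
    refine le_of_tendsto_of_tendsto ((hlim'.sub (hku.mono_left h𝒰)).norm)
      (((hkn.mono_left h𝒰).pow 2).const_mul C) ?_
    filter_upwards [hev] with n hn
    exact (H (k n) (u n) hn.1 hn.2).2.2
  set f : ℝ → E := fun t => c.coord (γ t) with hf
  have hγ0 : γ 0 = 1 := by simpa using hadd 0 0
  have hf0 : f 0 = 0 := by simp [hf, hγ0, c.coord_one]
  have hsmall : ∀ᶠ t in 𝓝 (0 : ℝ), |t| * ‖X‖ < r := by
    have : Tendsto (fun t : ℝ => |t| * ‖X‖) (𝓝 0) (𝓝 0) :=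
      (continuous_abs.mul continuous_const).tendsto' _ _ (by simp)
    exact this.eventually (gt_mem_nhds hr)
  have hright : HasDerivWithinAt f X (Set.Ici 0) 0 := by
    have hO : (fun t => f t - t • X) =O[𝓝[≥] (0 : ℝ)] fun t => ‖t - 0‖ ^ 2 := by
      refine Asymptotics.IsBigO.of_bound (C * ‖X‖ ^ 2) ?_
      filter_upwards [self_mem_nhdsWithin, nhdsWithin_le_nhds hsmall] with t ht htr
      have ht' : (0 : ℝ) ≤ t := ht
      have := (hpos t ht' (by rwa [abs_of_nonneg ht'] at htr)).2.2
      simp only [sub_zero, Real.norm_of_nonneg ht', norm_pow]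
      calc _ ≤ _ := this
        _ = _ := by ring
    have h1 := (hO.hasFDerivWithinAt (𝕜 := ℝ) (by simp) one_lt_two).hasDerivWithinAt.add
      ((hasDerivWithinAt_id (0 : ℝ) _).smul_const X)
    exact (h1.congr (fun t _ => by simp) (by simp)).congr_deriv (by simp)
  have hneg : ∀ t, γ (-t) = (γ t)⁻¹ := fun t => by
    rw [eq_inv_iff_mul_eq_one, ← hadd, neg_add_cancel, hγ0]
  -- The power estimates cover `t ≥ 0` only; negative times follow from `γ t = (γ (-t))⁻¹` and the
  -- derivative `-id` of inversion.
  have hleft : HasDerivWithinAt f X (Set.Iic 0) 0 := by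
    have h1 : HasDerivWithinAt (fun t => f (-t)) (-X) (Set.Iic 0) 0 := by
      have := HasDerivWithinAt.scomp_of_eq (0 : ℝ) hright
        ((hasDerivAt_neg (0 : ℝ)).hasDerivWithinAt (s := Set.Iic 0))
        (fun t (ht : t ≤ 0) => by simpa using ht) (by simp)
      exact this.congr_deriv (by simp)
    have h2 : HasDerivWithinAt (c.invC ∘ fun t => f (-t)) X (Set.Iic 0) 0 := by
      have := HasFDerivAt.comp_hasDerivWithinAt_of_eq (0 : ℝ) c.hasFDerivAt_invC h1
        (by simp [hf0])
      simpa using this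
    refine h2.congr_of_eventuallyEq ?_ (by simp [hf0, invC, c.point_zero, c.coord_one])
    filter_upwards [self_mem_nhdsWithin, nhdsWithin_le_nhds hsmall] with t ht htr
    have ht' : (0 : ℝ) ≤ -t := by simpa using ht
    have := (hpos (-t) ht' (by rwa [← abs_neg, abs_of_nonneg ht'] at htr)).1
    simp only [hf, invC, Function.comp_apply, ← this]
    rw [hneg, inv_inv]
  have hder : HasDerivAt f X 0 := by
    have := hleft.union hright
    rwa [Set.Iic_union_Ici, hasDerivWithinAt_univ] at this
  refine ⟨γ, ⟨hadd, ?_, hder⟩, hmem⟩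
  have hright' : Tendsto γ (𝓝[≥] 0) (𝓝 1) := by
    have h1 : Tendsto (fun t => c.point (f t)) (𝓝 0) (𝓝 1) := by
      have := hder.continuousAt.tendsto
      rw [hf0] at this
      exact c.tendsto_point.comp this
    refine (h1.mono_left nhdsWithin_le_nhds).congr' ?_
    filter_upwards [self_mem_nhdsWithin, nhdsWithin_le_nhds hsmall] with t ht htr
    have ht' : (0 : ℝ) ≤ t := ht
    exact ((hpos t ht' (by rwa [abs_of_nonneg ht'] at htr)).1).symm
  have hleft' : Tendsto γ (𝓝[≤] 0) (𝓝 1) := by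
    have h1 : Tendsto (fun t : ℝ => -t) (𝓝[≤] 0) (𝓝[≥] 0) :=
      tendsto_nhdsWithin_iff.mpr ⟨(continuous_neg.tendsto' _ _ (by simp)).mono_left
        nhdsWithin_le_nhds, by
          filter_upwards [self_mem_nhdsWithin] with t ht
          simpa using ht⟩
    have h2 := (hright'.comp h1).inv
    rw [inv_one] at h2
    refine h2.congr fun t => ?_
    simp [hneg]
  rw [← nhdsLE_sup_nhdsGE]
  exact hleft'.sup hright'

theorem exists_oneParam [IsTopologicalGroup G] [T2Space G] [CompactSpace G]
    [FiniteDimensional ℝ E] (X : E) : ∃ γ : ℝ → G, c.IsOneParam γ X := by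
  have hpos : ∀ n : ℕ, (0 : ℝ) < 1 / ((n : ℝ) + 1) := fun n => by positivity
  obtain ⟨γ, h, -⟩ := c.exists_oneParam_of_tendsto (A := ⊤) isClosed_univ
    (u := fun n : ℕ => (1 / ((n : ℝ) + 1)) • X) (δ := fun n : ℕ => 1 / ((n : ℝ) + 1)) (X := X)
    hpos tendsto_one_div_add_atTop_nhds_zero_nat
    (tendsto_const_nhds.congr fun n => (inv_smul_smul₀ (hpos n).ne' X).symm) (fun _ => trivial)
  exact ⟨γ, h⟩

theorem IsOneParam.mul [IsTopologicalGroup G] {c : LocalCoord E G} {γ η : ℝ → G} {X Y : E}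
    (h : c.IsOneParam γ X) (h' : c.IsOneParam η Y) (hc : ∀ s t, γ s * η t = η t * γ s) :
    c.IsOneParam (fun t => γ t * η t) (X + Y) where
  map_add s t := by
    rw [h.map_add, h'.map_add, mul_assoc, mul_assoc, ← mul_assoc (γ t), hc t s, mul_assoc]
  tendsto := by simpa using h.tendsto.mul h'.tendsto
  hasDerivAt := by
    have h1 := HasFDerivAt.comp_hasDerivAt_of_eq (0 : ℝ) c.hasStrictFDerivAt_mulC.hasFDerivAt
      (h.hasDerivAt.prodMk h'.hasDerivAt) (by simp [h.map_zero, h'.map_zero, c.coord_one, Prod.zero_eq_mk])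
    refine (h1.congr_of_eventuallyEq ?_).congr_deriv (by simp)
    filter_upwards [h.tendsto.eventually c.point_coord, h'.tendsto.eventually c.point_coord]
      with t a b
    simp [mulC, a, b]

theorem IsOneParam.map {c : LocalCoord E G} {γ : ℝ → G} {X : E} (h : c.IsOneParam γ X)
    {f : G →* G} {L : E →L[ℝ] E} (hf : ContinuousAt f 1)
    (hL : HasFDerivAt (fun u => c.coord (f (c.point u))) L 0) :
    c.IsOneParam (fun t => f (γ t)) (L X) where
  map_add s t := by rw [h.map_add, map_mul]
  tendsto := by
    have := hf.tendsto.comp h.tendsto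
    rwa [map_one] at this
  hasDerivAt := by
    have h1 := HasFDerivAt.comp_hasDerivAt_of_eq (0 : ℝ) hL h.hasDerivAt
      (by simp [h.map_zero, c.coord_one])
    refine h1.congr_of_eventuallyEq ?_
    filter_upwards [h.tendsto.eventually c.point_coord] with t a
    simp [a]

end LocalCoord

/-! ### The exponential map and closed abelian subgroups -/

/-- The elements of `A` commute with each other. -/
def IsAbelian {G : Type*} [Group G] (A : Subgroup G) : Prop := ∀ a ∈ A, ∀ b ∈ A, a * b = b * a

namespace LocalCoord

variable {E G : Type*} [NormedAddCommGroup E] [NormedSpace ℝ E] [FiniteDimensional ℝ E] [Group G]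
    [TopologicalSpace G] [IsTopologicalGroup G] [T2Space G] [CompactSpace G] (c : LocalCoord E G)

/-- The exponential map. -/
def exp (X : E) : G := (c.exists_oneParam X).choose 1

variable {c} in
theorem IsOneParam.eq_exp {γ : ℝ → G} {X : E} (h : c.IsOneParam γ X) (t : ℝ) :
    γ t = c.exp (t • X) := by
  have h1 := h.comp_mul t
  have h2 := h1.eq (c.exists_oneParam (t • X)).choose_spec
  have := congrFun h2 1
  simpa [exp] using this

theorem isOneParam_exp (X : E) : c.IsOneParam (fun t => c.exp (t • X)) X := by
  have h := (c.exists_oneParam X).choose_spec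
  have : (fun t : ℝ => c.exp (t • X)) = (c.exists_oneParam X).choose := by
    funext t; exact (h.eq_exp t).symm
  rwa [this]

theorem exp_zero : c.exp 0 = 1 := by
  simpa using (c.isOneParam_exp 0).map_zero

theorem exp_neg (X : E) : c.exp (-X) = (c.exp X)⁻¹ := by
  simpa using (c.isOneParam_exp X).map_neg 1

theorem continuous_exp_smul (X : E) : Continuous fun t : ℝ => c.exp (t • X) :=
  (c.isOneParam_exp X).continuous

theorem exp_smul_add {X Y : E}
    (h : ∀ s t : ℝ, c.exp (s • X) * c.exp (t • Y) = c.exp (t • Y) * c.exp (s • X)) (t : ℝ) :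
    c.exp (t • (X + Y)) = c.exp (t • X) * c.exp (t • Y) :=
  (((c.isOneParam_exp X).mul (c.isOneParam_exp Y) h).eq_exp t).symm

theorem exists_exp_bound : ∃ r > 0, ∃ C > 0, ∀ X : E, ‖X‖ < r →
    c.exp X = c.point (c.coord (c.exp X)) ∧ ‖c.coord (c.exp X) - X‖ ≤ C * ‖X‖ ^ 2 := by
  obtain ⟨r, hr, C, hC, H⟩ := c.exists_oneParam_bound
  refine ⟨r, hr, C, hC, fun X hX => ?_⟩
  simpa using H _ X 1 (c.isOneParam_exp X) (by simpa using hX)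

theorem exists_exp_lower : ∃ r > 0, ∀ X : E, ‖X‖ < r → ‖X‖ ≤ 2 * ‖c.coord (c.exp X)‖ := by
  obtain ⟨r, hr, C, hC, H⟩ := c.exists_exp_bound
  refine ⟨min r (1 / (2 * C)), by positivity, fun X hX => ?_⟩
  have h1 := (H X (lt_of_lt_of_le hX (min_le_left _ _))).2
  have h2 : C * ‖X‖ ≤ 1 / 2 := by
    have := (lt_of_lt_of_le hX (min_le_right _ _)).le
    calc C * ‖X‖ ≤ C * (1 / (2 * C)) := by gcongr
      _ = 1 / 2 := by field_simp
  have h3 : ‖X‖ ≤ ‖c.coord (c.exp X)‖ + ‖c.coord (c.exp X) - X‖ := by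
    have := norm_sub_le (c.coord (c.exp X)) (c.coord (c.exp X) - X)
    simpa using this
  nlinarith [norm_nonneg X]

theorem exists_exp_inj : ∃ r > 0, ∀ X : E, ‖X‖ < r → c.exp X = 1 → X = 0 := by
  obtain ⟨r, hr, H⟩ := c.exists_exp_lower
  refine ⟨r, hr, fun X hX h => ?_⟩
  have := H X hX
  rw [h, c.coord_one, norm_zero, mul_zero] at this
  exact norm_le_zero_iff.mp this

theorem tendsto_exp : Tendsto c.exp (𝓝 0) (𝓝 1) := by
  obtain ⟨r, hr, C, hC, H⟩ := c.exists_exp_bound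
  have hn : Tendsto (fun X : E => ‖X‖) (𝓝 0) (𝓝 0) := continuous_norm.tendsto' _ _ norm_zero
  have hev : ∀ᶠ X : E in 𝓝 0, ‖X‖ < r := hn.eventually (gt_mem_nhds hr)
  have h1 : Tendsto (fun X => c.coord (c.exp X) - X) (𝓝 0) (𝓝 0) := by
    refine squeeze_zero_norm' (hev.mono fun X hX => (H X hX).2) ?_
    simpa using (hn.pow 2).const_mul C
  have h2 : Tendsto (fun X => c.coord (c.exp X)) (𝓝 0) (𝓝 0) := by
    have := h1.add (tendsto_id (α := E) (x := 𝓝 0))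
    simpa using this
  exact (c.tendsto_point.comp h2).congr' (hev.mono fun X hX => (H X hX).1.symm)

/-- The Lie algebra of a subgroup (used for abelian subgroups): the span of the velocities of the
one-parameter subgroups inside it. -/
def lie (A : Subgroup G) : Submodule ℝ E := Submodule.span ℝ {X | ∀ t : ℝ, c.exp (t • X) ∈ A}

variable {c} {A B : Subgroup G}

/-- For abelian `A` the span in `lie` adds nothing, since the product of two commuting one-parameter
subgroups is the one-parameter subgroup of the sum. -/
theorem mem_lie (hA : IsAbelian A) {X : E} : X ∈ c.lie A ↔ ∀ t : ℝ, c.exp (t • X) ∈ A := by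
  refine ⟨fun h => ?_, fun h => Submodule.subset_span h⟩
  induction h using Submodule.span_induction with
  | mem X h => exact h
  | zero => simp [c.exp_zero, A.one_mem]
  | add X Y _ _ hX hY =>
    intro t
    rw [c.exp_smul_add fun s t => hA _ (hX s) _ (hY t)]
    exact A.mul_mem (hX t) (hY t)
  | smul a X _ hX =>
    intro t
    rw [smul_smul]
    exact hX _

theorem exp_mem (hA : IsAbelian A) {X : E} (h : X ∈ c.lie A) : c.exp X ∈ A := by
  simpa using (mem_lie hA).mp h 1

theorem lie_mono (h : A ≤ B) : c.lie A ≤ c.lie B :=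
  Submodule.span_mono fun _ hX t => h (hX t)

theorem exp_add (hA : IsAbelian A) {X Y : E} (hX : X ∈ c.lie A) (hY : Y ∈ c.lie A) :
    c.exp (X + Y) = c.exp X * c.exp Y := by
  simpa using c.exp_smul_add (fun s t => hA _ ((mem_lie hA).mp hX s) _ ((mem_lie hA).mp hY t)) 1

/-- The exponential map of an abelian subgroup as a homomorphism. -/
def expHom (hA : IsAbelian A) : Multiplicative (c.lie A) →* G where
  toFun X := c.exp (X.toAdd : E)
  map_one' := c.exp_zero
  map_mul' X Y := exp_add hA X.toAdd.2 Y.toAdd.2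

theorem continuous_expHom (hA : IsAbelian A) : Continuous (expHom (c := c) hA) := by
  refine continuous_of_continuousAt_one _ ?_
  rw [ContinuousAt, map_one]
  exact c.tendsto_exp.comp (continuous_subtype_val.tendsto' (0 : c.lie A) 0 rfl)

theorem continuousOn_exp (hA : IsAbelian A) : ContinuousOn c.exp (c.lie A) := by
  rw [continuousOn_iff_continuous_domRestrict]
  exact continuous_expHom (c := c) hA

/-- A closed abelian subgroup is, near the identity, the image of its Lie algebra. -/
theorem eventually_mem_exp_lie (hA : IsAbelian A) (hcl : IsClosed (A : Set G))
    {r₀ : ℝ} (hr₀ : 0 < r₀) :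
    ∀ᶠ g in 𝓝 (1 : G), g ∈ A → ∃ X ∈ c.lie A, ‖X‖ < r₀ ∧ c.exp X = g := by
  have : ProperSpace E := FiniteDimensional.proper ℝ E
  -- Otherwise there are `g n → 1` in `A` outside the image of small vectors of the Lie algebra. The
  -- best approximations `exp (X n)` of `g n` leave residuals whose directions accumulate at a new
  -- velocity `Y` of `A`, and moving along `Y` improves the approximation.
  by_contra hcon
  rw [not_eventually] at hcon
  obtain ⟨r₁, hr₁, C₁, hC₁, H₁⟩ := c.exists_exp_bound
  obtain ⟨r₂, hr₂, H₂⟩ := c.exists_exp_lower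
  obtain ⟨ρ, hρ, C₂, hC₂, H₃⟩ := c.exists_law
  have hW : ∀ᶠ g in 𝓝 (1 : G), ContinuousAt c.coord g ∧ c.point (c.coord g) = g :=
    c.continuousAt_coord.and c.point_coord
  have ht : Tendsto (fun z : E × G => (c.exp z.1)⁻¹ * z.2) (𝓝 0 ×ˢ 𝓝 1) (𝓝 1) := by
    simpa using ((c.tendsto_exp.comp tendsto_fst).inv).mul tendsto_snd
  obtain ⟨pa, hpa, pb, hpb, hW'⟩ := eventually_prod_iff.mp (ht.eventually hW)
  obtain ⟨R₀, hR₀, hpa'⟩ := Metric.eventually_nhds_iff.mp hpa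
  set R := min (R₀ / 2) (min (r₂ / 2) (r₀ / 2)) with hR
  have hRpos : 0 < R := by positivity
  have hRR : ∀ {X : E}, ‖X‖ ≤ R → ∀ {g}, pb g →
      ContinuousAt c.coord ((c.exp X)⁻¹ * g) ∧
        c.point (c.coord ((c.exp X)⁻¹ * g)) = (c.exp X)⁻¹ * g := by
    intro X hX g hg
    have : R ≤ R₀ / 2 := min_le_left _ _
    exact hW' (hpa' (by simpa using lt_of_le_of_lt (hX.trans this) (by linarith))) hg
  have hpick : ∀ n : ℕ, ∃ g : G, (pb g ∧ ‖c.coord g‖ < 1 / ((n : ℝ) + 1) ∧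
      c.point (c.coord g) = g) ∧ g ∈ A ∧ ∀ X ∈ c.lie A, ‖X‖ < r₀ → c.exp X ≠ g := by
    intro n
    have h2 : ∀ᶠ g in 𝓝 (1 : G), ‖c.coord g‖ < 1 / ((n : ℝ) + 1) := by
      have := c.tendsto_coord.norm
      rw [norm_zero] at this
      exact this.eventually (gt_mem_nhds (by positivity))
    obtain ⟨g, hg, hg'⟩ := (hcon.and_eventually (hpb.and (h2.and c.point_coord))).exists
    push Not at hg
    exact ⟨g, hg', hg⟩
  choose g hg hgA hgne using hpick
  set K : Set E := (c.lie A : Set E) ∩ Metric.closedBall 0 R with hK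
  have hKc : IsCompact K :=
    (isCompact_closedBall (0 : E) R).inter_left (c.lie A).closed_of_finiteDimensional
  have hK0 : (0 : E) ∈ K := ⟨Submodule.zero_mem _, by simpa using hRpos.le⟩
  have hmin : ∀ n, ∃ X ∈ K, ∀ Y ∈ K, ‖c.coord ((c.exp X)⁻¹ * g n)‖ ≤
      ‖c.coord ((c.exp Y)⁻¹ * g n)‖ := by
    intro n
    obtain ⟨X, hX, hm⟩ := hKc.exists_isMinOn (f := fun X => ‖c.coord ((c.exp X)⁻¹ * g n)‖) ⟨0, hK0⟩
      (by
        intro X hX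
        have h1 : ContinuousAt c.coord ((c.exp X)⁻¹ * g n) :=
          (hRR (by simpa using hX.2) (hg n).1).1
        have h2 : ContinuousWithinAt (fun X => (c.exp X)⁻¹ * g n) K X :=
          (((continuousOn_exp hA).mono Set.inter_subset_left X hX).inv).mul
            continuousWithinAt_const
        exact (ContinuousAt.comp_continuousWithinAt
          (f := fun X => (c.exp X)⁻¹ * g n) h1 h2).norm)
    exact ⟨X, hX, fun Y hY => hm hY⟩
  choose X hXK hXmin using hmin
  have hXR : ∀ n, ‖X n‖ ≤ R := fun n => by simpa using (hXK n).2
  set u : ℕ → E := fun n => c.coord ((c.exp (X n))⁻¹ * g n) with hu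
  have hpu : ∀ n, c.point (u n) = (c.exp (X n))⁻¹ * g n := fun n => (hRR (hXR n) (hg n).1).2
  have hu_le : ∀ n : ℕ, ‖u n‖ ≤ 1 / ((n : ℝ) + 1) := fun n => by
    have := hXmin n 0 hK0
    rw [c.exp_zero, inv_one, one_mul] at this
    exact this.trans (hg n).2.1.le
  have hu0 : Tendsto u atTop (𝓝 0) :=
    squeeze_zero_norm hu_le tendsto_one_div_add_atTop_nhds_zero_nat
  have hune : ∀ n, u n ≠ 0 := by
    intro n h0
    have := hpu n
    rw [h0, c.point_zero, eq_comm, inv_mul_eq_one] at this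
    have hR0 : R ≤ r₀ / 2 := (min_le_right _ _).trans (min_le_right _ _)
    exact hgne n (X n) (hXK n).1 (by linarith [hXR n]) this
  have hupos : ∀ n, 0 < ‖u n‖ := fun n => norm_pos_iff.mpr (hune n)
  have hg1 : Tendsto g atTop (𝓝 1) := by
    have h0 : Tendsto (fun n => c.coord (g n)) atTop (𝓝 0) :=
      squeeze_zero_norm (fun n => (hg n).2.1.le) tendsto_one_div_add_atTop_nhds_zero_nat
    exact (c.tendsto_point.comp h0).congr fun n => (hg n).2.2
  have hX0 : Tendsto X atTop (𝓝 0) := by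
    have h1 : Tendsto (fun n => c.exp (X n)) atTop (𝓝 1) := by
      have := hg1.mul (c.tendsto_point.comp hu0).inv
      rw [inv_one, mul_one] at this
      refine this.congr fun n => ?_
      simp [hpu]
    have h2 : Tendsto (fun n => 2 * ‖c.coord (c.exp (X n))‖) atTop (𝓝 0) := by
      simpa using ((c.tendsto_coord.comp h1).norm).const_mul 2
    refine squeeze_zero_norm (fun n => H₂ (X n) ?_) h2
    have : R ≤ r₂ / 2 := (min_le_right _ _).trans (min_le_left _ _)
    linarith [hXR n]
  -- The residuals lie in `A` and tend to `1`, so the limit `Y` of their normalized coordinates is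
  -- the velocity of a one-parameter subgroup of the closed group `A`.
  obtain ⟨Y, hY, φ, hφ, hlim⟩ := (isCompact_sphere (0 : E) 1).tendsto_subseq
    (x := fun n => ‖u n‖⁻¹ • u n) (fun n => by
      simp [norm_smul, inv_mul_cancel₀ (hupos n).ne'])
  have hY1 : ‖Y‖ = 1 := by simpa using hY
  have hφt := hφ.tendsto_atTop
  have hδ0 : Tendsto (fun n => ‖u (φ n)‖) atTop (𝓝 0) := by
    simpa using (hu0.comp hφt).norm
  obtain ⟨γ, hγ, hγA⟩ := c.exists_oneParam_of_tendsto hcl (u := fun n => u (φ n))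
    (δ := fun n => ‖u (φ n)‖) (fun n => hupos _) hδ0 hlim (fun n => by
      rw [hpu]
      exact A.mul_mem (A.inv_mem (exp_mem hA (hXK _).1)) (hgA _))
  have hYA : Y ∈ c.lie A := (mem_lie hA).mpr fun t => by rw [← hγ.eq_exp]; exact hγA t
  have hsmall : ∀ {a : ℝ}, 0 < a → ∀ᶠ n in atTop, ‖u (φ n)‖ < a := fun {a} ha =>
    hδ0.eventually (gt_mem_nhds ha)
  have hev1 : ∀ᶠ n in atTop, ‖‖u (φ n)‖⁻¹ • u (φ n) - Y‖ < 1 / 4 := by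
    have := (hlim.sub_const Y).norm
    rw [sub_self, norm_zero] at this
    exact this.eventually (gt_mem_nhds (by norm_num))
  have hev2 : ∀ᶠ n in atTop, ‖X (φ n) + ‖u (φ n)‖ • Y‖ < R := by
    have := ((hX0.comp hφt).add (hδ0.smul_const Y)).norm
    simp only [zero_smul, add_zero, norm_zero] at this
    exact this.eventually (gt_mem_nhds hRpos)
  obtain ⟨n, h1, h2, h3, h4, h5, h6⟩ := (hev1.and (hev2.and ((hsmall (half_pos hρ)).and
    ((hsmall hr₁).and ((hsmall (show 0 < 1 / (4 * (C₁ + 2 * C₂)) by positivity)).and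
      (hsmall (show 0 < 1 / C₁ by positivity))))))).exists
  set v := u (φ n) with hv
  set d := ‖v‖ with hd
  have hdpos : 0 < d := hupos _
  set a := c.coord (c.exp (-(d • Y))) with ha
  have hnorm : ‖-(d • Y)‖ = d := by rw [norm_neg, norm_smul, hY1, mul_one, Real.norm_of_nonneg hdpos.le]
  obtain ⟨e1, e2⟩ := H₁ (-(d • Y)) (by rw [hnorm]; exact h4)
  rw [← ha] at e1 e2
  rw [hnorm] at e2
  have ha2 : ‖a‖ ≤ 2 * d := by
    have hq : C₁ * d ≤ 1 := by
      calc C₁ * d ≤ C₁ * (1 / C₁) := by gcongr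
        _ = 1 := by field_simp
    have : ‖a‖ ≤ ‖a - -(d • Y)‖ + ‖-(d • Y)‖ := by
      simpa using norm_add_le (a - -(d • Y)) (-(d • Y))
    rw [hnorm] at this
    nlinarith
  have hmul := (H₃ a v (by linarith) (by linarith)).2.1
  have hval : c.coord ((c.exp (X (φ n) + d • Y))⁻¹ * g (φ n)) = c.mulC a v := by
    rw [mulC, ← e1, hpu, c.exp_neg, exp_add hA (hXK _).1 (Submodule.smul_mem _ _ hYA),
      hA _ (exp_mem hA (hXK _).1) _ (exp_mem hA (Submodule.smul_mem _ _ hYA)), mul_inv_rev,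
      ← mul_assoc, hA _ (A.inv_mem (exp_mem hA (hXK _).1)) _
        (A.inv_mem (exp_mem hA (Submodule.smul_mem _ _ hYA)))]
  -- Minimality of `X (φ n)` against the competitor `X (φ n) + d • Y`, whose residual is the product
  -- with coordinate `c.mulC a v`.
  have hle : d ≤ ‖c.mulC a v‖ := by
    have := hXmin (φ n) (X (φ n) + d • Y)
      ⟨Submodule.add_mem _ (hXK _).1 (Submodule.smul_mem _ _ hYA), by simpa using h2.le⟩
    rwa [hval] at this
  have hvY : ‖v - d • Y‖ ≤ d / 4 := by
    have : v - d • Y = d • (d⁻¹ • v - Y) := by rw [smul_sub, smul_inv_smul₀ hdpos.ne']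
    rw [this, norm_smul, Real.norm_of_nonneg hdpos.le]
    nlinarith
  have hfin : ‖c.mulC a v‖ ≤ C₂ * (2 * d) * d + C₁ * d ^ 2 + d / 4 := by
    calc _ = ‖(c.mulC a v - a - v) + (a - -(d • Y)) + (v - d • Y)‖ := by congr 1; abel
      _ ≤ _ := norm_add₃_le
      _ ≤ C₂ * ‖a‖ * d + C₁ * d ^ 2 + d / 4 := by gcongr
      _ ≤ _ := by gcongr
  -- Hence the competitor's residual is at most `d / 4 + d / 4 < d`.
  have hq : (C₁ + 2 * C₂) * d ≤ 1 / 4 := by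
    calc (C₁ + 2 * C₂) * d ≤ (C₁ + 2 * C₂) * (1 / (4 * (C₁ + 2 * C₂))) := by gcongr
      _ = 1 / 4 := by field_simp
  nlinarith

end LocalCoord

/-! ### Compact quotients of vector spaces are tori -/

section TorusQuotient

/-- By σ-compactness of `V` the map `e` is open, hence a quotient map, so the algebraic isomorphism
of the two quotients is continuous; a continuous bijection from a compact to a Hausdorff space is a
homeomorphism. -/
theorem exists_continuousMulEquiv_of_ker_eq {V A B : Type*} [Group V] [TopologicalSpace V]
    [IsTopologicalGroup V] [SigmaCompactSpace V] [Group A] [TopologicalSpace A]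
    [IsTopologicalGroup A] [CompactSpace A] [T2Space A] [Group B] [TopologicalSpace B]
    [T2Space B] (e : V →* A) (q : V →* B)
    (he : Continuous e) (hq : Continuous q) (hes : Function.Surjective e)
    (hqs : Function.Surjective q) (hker : e.ker = q.ker) : Nonempty (A ≃ₜ* B) := by
  have heq : IsQuotientMap e := (e.isOpenMap_of_sigmaCompact hes he).isQuotientMap he hes
  let f : A ≃* B := (QuotientGroup.quotientKerEquivOfSurjective e hes).symm.trans
    ((QuotientGroup.quotientMulEquivOfEq hker).trans
      (QuotientGroup.quotientKerEquivOfSurjective q hqs))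
  have hf : ∀ v, f (e v) = q v := by
    intro v
    have : (QuotientGroup.quotientKerEquivOfSurjective e hes).symm (e v) =
        (QuotientGroup.mk v : V ⧸ e.ker) := by
      rw [MulEquiv.symm_apply_eq]; rfl
    simp only [f, MulEquiv.trans_apply, this]
    rfl
  have hfc : Continuous f := by
    rw [heq.continuous_iff]
    exact hq.congr fun v => (hf v).symm
  exact ⟨⟨f, hfc, (hfc.homeoOfEquivCompactToT2 (f := f.toEquiv)).symm.continuous⟩⟩

variable {V : Type*} [NormedAddCommGroup V] [NormedSpace ℝ V]

/-- The coordinatewise exponential of a basis. -/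
def circleHom {ι : Type*} (b : Module.Basis ι ℝ V) : Multiplicative V →* (ι → Circle) where
  toFun v i := Circle.exp (2 * Real.pi * b.repr v.toAdd i)
  map_one' := by ext; simp
  map_mul' v w := by
    funext i
    simp [mul_add, Circle.exp_add]

theorem continuous_circleHom [FiniteDimensional ℝ V] {ι : Type*} (b : Module.Basis ι ℝ V) : Continuous (circleHom b) := by
  refine continuous_pi fun i => ?_
  have : Continuous fun v : V => b.coord i v := LinearMap.continuous_of_finiteDimensional _
  exact Circle.exp.continuous.comp (continuous_const.mul this)

theorem surjective_circleHom {ι : Type*} [Finite ι] (b : Module.Basis ι ℝ V) :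
    Function.Surjective (circleHom b) := by
  intro z
  choose t ht using fun i => Circle.exp_surjective (z i)
  refine ⟨Multiplicative.ofAdd (b.equivFun.symm fun i => t i / (2 * Real.pi)), ?_⟩
  funext i
  have hpi := Real.pi_ne_zero
  have h : b.repr (b.equivFun.symm fun i => t i / (2 * Real.pi)) i = t i / (2 * Real.pi) := by
    rw [← Module.Basis.equivFun_apply, LinearEquiv.apply_symm_apply]
  change Circle.exp (2 * Real.pi * b.repr (b.equivFun.symm fun i => t i / (2 * Real.pi)) i) = z i
  rw [h, ← ht i]
  congr 1
  field_simp

theorem mem_ker_circleHom {ι : Type*} [Finite ι] (b : Module.Basis ι ℝ V) (v : V) :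
    circleHom b (Multiplicative.ofAdd v) = 1 ↔ v ∈ Submodule.span ℤ (Set.range b) := by
  rw [Module.Basis.mem_span_iff_repr_mem, funext_iff]
  refine forall_congr' fun i => ?_
  change Circle.exp (2 * Real.pi * b.repr v i) = 1 ↔ _
  rw [Circle.exp_eq_one]
  have hpi := Real.pi_pos
  constructor
  · rintro ⟨n, hn⟩
    refine ⟨n, ?_⟩
    have : 2 * Real.pi * (b.repr v i - n) = 0 := by linarith
    have := (mul_eq_zero.mp this).resolve_left (by positivity)
    simpa using (sub_eq_zero.mp this).symm
  · rintro ⟨n, hn⟩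
    refine ⟨n, ?_⟩
    rw [← hn]
    simp only [algebraMap_int_eq, eq_intCast]
    ring

variable [FiniteDimensional ℝ V] {A : Type*} [Group A] [TopologicalSpace A] [IsTopologicalGroup A] [CompactSpace A]
  [T2Space A]

/-- A nonzero linear form vanishing on the kernel would descend to a continuous surjection from the
compact group `A` onto `ℝ`. -/
theorem span_ker_eq_top (e : Multiplicative V →* A) (he : Continuous e)
    (hs : Function.Surjective e) :
    Submodule.span ℝ {v : V | e (Multiplicative.ofAdd v) = 1} = ⊤ := by
  have : ProperSpace V := FiniteDimensional.proper ℝ V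
  have : SigmaCompactSpace (Multiplicative V) := inferInstanceAs (SigmaCompactSpace V)
  by_contra hne
  obtain ⟨f, hf, hle⟩ := Submodule.exists_le_ker_of_lt_top _ (lt_top_iff_ne_top.mpr hne)
  have hq : IsQuotientMap e := (e.isOpenMap_of_sigmaCompact hs he).isQuotientMap he hs
  let φ : A → ℝ := fun a => f (Function.surjInv hs a).toAdd
  have hφ : ∀ v : Multiplicative V, φ (e v) = f v.toAdd := by
    intro v
    have h1 : e (Function.surjInv hs (e v)) = e v := Function.surjInv_eq hs (e v)
    have h2 : e (Multiplicative.ofAdd ((Function.surjInv hs (e v)).toAdd - v.toAdd)) = 1 := by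
      rw [ofAdd_sub, map_div]
      simp [h1]
    have h3 : f ((Function.surjInv hs (e v)).toAdd - v.toAdd) = 0 := hle (Submodule.subset_span h2)
    rw [map_sub, sub_eq_zero] at h3
    exact h3
  have hφc : Continuous φ := by
    rw [hq.continuous_iff]
    have : Continuous f := LinearMap.continuous_of_finiteDimensional f
    exact (this.comp continuous_toAdd).congr fun v => (hφ v).symm
  obtain ⟨w, hw⟩ : ∃ w, f w ≠ 0 := by
    by_contra hcon
    push Not at hcon
    exact hf (LinearMap.ext hcon)
  have hrange : Set.range φ = Set.univ := by
    refine Set.eq_univ_of_forall fun t => ⟨e (Multiplicative.ofAdd ((t / f w) • w)), ?_⟩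
    rw [hφ]
    simp [hw]
  exact noncompact_univ ℝ (hrange ▸ isCompact_range hφc)

/-- The kernel is discrete by `hinj` and spans by `span_ker_eq_top`, so it is a lattice. In a real
basis made of lattice generators, the coordinatewise circle exponential has the same kernel as `e`.
-/
theorem exists_equiv_torus (e : Multiplicative V →* A) (he : Continuous e)
    (hs : Function.Surjective e)
    (hinj : ∃ r > 0, ∀ v : V, ‖v‖ < r → e (Multiplicative.ofAdd v) = 1 → v = 0) :
    Nonempty (A ≃ₜ* (Fin (Module.finrank ℝ V) → Circle)) := by
  have : ProperSpace V := FiniteDimensional.proper ℝ V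
  have : SigmaCompactSpace (Multiplicative V) := inferInstanceAs (SigmaCompactSpace V)
  let Λ : Submodule ℤ V := AddSubgroup.toIntSubmodule
    { carrier := {v : V | e (Multiplicative.ofAdd v) = 1}
      zero_mem' := map_one e
      add_mem' := fun {v w} hv hw => by
        change e (Multiplicative.ofAdd (v + w)) = 1
        rw [ofAdd_add, map_mul, hv, hw, one_mul]
      neg_mem' := fun {v} hv => by
        change e (Multiplicative.ofAdd (-v)) = 1
        rw [ofAdd_neg, map_inv, hv, inv_one] }
  have hΛ : ∀ v, v ∈ Λ ↔ e (Multiplicative.ofAdd v) = 1 := fun v => Iff.rfl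
  obtain ⟨r, hr, hinj⟩ := hinj
  have hdisc : DiscreteTopology Λ := by
    refine discreteTopology_of_isOpen_singleton_zero ?_
    have : ({0} : Set Λ) = {v : Λ | ‖(v : V)‖ < r} := by
      ext v
      simp only [Set.mem_singleton_iff, Set.mem_ofPred_eq]
      constructor
      · rintro rfl; simpa using hr
      · intro h
        exact Subtype.ext (hinj v h ((hΛ v).mp v.2))
    rw [this]
    exact isOpen_lt (continuous_norm.comp continuous_subtype_val) continuous_const
  have hlat : IsZLattice ℝ Λ := ⟨span_ker_eq_top e he hs⟩
  have : Module.Finite ℤ Λ := ZLattice.module_finite ℝ Λ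
  let b₀ := Module.Free.chooseBasis ℤ Λ
  let b := b₀.ofZLatticeBasis ℝ Λ
  let b' := b.reindex (Fintype.equivFinOfCardEq (Module.finrank_eq_card_basis b).symm)
  refine exists_continuousMulEquiv_of_ker_eq e (circleHom b') he (continuous_circleHom b') hs
    (surjective_circleHom b') ?_
  ext v
  rw [MonoidHom.mem_ker, MonoidHom.mem_ker]
  refine (hΛ v.toAdd).symm.trans ((Iff.trans ?_ (mem_ker_circleHom b' v.toAdd).symm))
  rw [Module.Basis.range_reindex, Module.Basis.ofZLatticeBasis_span]

/-- The elements of order dividing two number `2 ^ n` in one group and `2 ^ m` in the other. -/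
theorem torus_dim_unique {n m : ℕ} (f : (Fin n → Circle) ≃* (Fin m → Circle)) : n = m := by
  have hcard : ∀ k : ℕ, Nat.card {z : Fin k → Circle // z ^ 2 = 1} = 2 ^ k := by
    intro k
    have h1 : {z : Fin k → Circle // z ^ 2 = 1} ≃ (Fin k → {w : Circle // w ^ 2 = 1}) :=
      (Equiv.subtypeEquivRight fun z => by
        rw [funext_iff]; rfl).trans (Equiv.subtypePiEquivPi (p := fun _ (w : Circle) => w ^ 2 = 1))
    have h2 : Nat.card {w : Circle // w ^ 2 = 1} = 2 := by
      have : {w : Circle | w ^ 2 = 1} = {1, -1} := by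
        ext w
        simp only [Set.mem_ofPred_eq, Set.mem_insert_iff, Set.mem_singleton_iff, Circle.ext_iff,
          Circle.coe_pow, Circle.coe_one, Circle.coe_neg]
        exact sq_eq_one_iff
      change Set.ncard {w : Circle | w ^ 2 = 1} = 2
      rw [this]
      exact Set.ncard_pair (Circle.neg_ne_self 1).symm
    rw [Nat.card_congr h1, Nat.card_fun, h2, Nat.card_eq_fintype_card, Fintype.card_fin]
  have h : {z : Fin n → Circle // z ^ 2 = 1} ≃ {z : Fin m → Circle // z ^ 2 = 1} :=
    f.toEquiv.subtypeEquiv fun z => by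
      change z ^ 2 = 1 ↔ f z ^ 2 = 1
      rw [← map_pow, map_eq_one_iff f f.injective]
  have := Nat.card_congr h
  rw [hcard, hcard] at this
  exact Nat.pow_right_injective le_rfl this

end TorusQuotient

/-- Proper subspaces are null sets for Haar measure, hence so is a countable union of them. -/
theorem exists_notMem_of_countable {V ι : Type*} [NormedAddCommGroup V] [NormedSpace ℝ V]
    [FiniteDimensional ℝ V] [Countable ι] (W : ι → Submodule ℝ V) (hW : ∀ i, W i ≠ ⊤) :
    ∃ x, ∀ i, x ∉ W i := by
  borelize V
  let μ : MeasureTheory.Measure V := MeasureTheory.Measure.addHaar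
  have h0 : μ (⋃ i, (W i : Set V)) = 0 :=
    MeasureTheory.measure_iUnion_null fun i => MeasureTheory.Measure.addHaar_submodule μ _ (hW i)
  by_contra hcon
  push Not at hcon
  have : (⋃ i, (W i : Set V)) = Set.univ := Set.eq_univ_of_forall fun x => by
    simpa using hcon x
  rw [this] at h0
  exact NeZero.ne μ (MeasureTheory.Measure.measure_univ_eq_zero.mp h0)

/-! ### Tori as closed connected abelian subgroups -/

/-- Closed connected abelian subgroups. -/
structure IsToral {G : Type*} [Group G] [TopologicalSpace G] (A : Subgroup G) : Prop where
  isClosed : IsClosed (A : Set G)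
  isConnected : IsConnected (A : Set G)
  isAbelian : IsAbelian A

namespace LocalCoord

variable {E G : Type*} [NormedAddCommGroup E] [NormedSpace ℝ E] [FiniteDimensional ℝ E] [Group G]
    [TopologicalSpace G] [IsTopologicalGroup G] [T2Space G] [CompactSpace G] {c : LocalCoord E G}
    {A B C H : Subgroup G}

theorem range_expHom_le (hC : IsAbelian C) : (expHom (c := c) hC).range ≤ C := by
  rintro _ ⟨X, rfl⟩
  exact exp_mem hC X.toAdd.2

theorem mem_range_expHom (hC : IsAbelian C) {g : G} :
    g ∈ (expHom (c := c) hC).range ↔ ∃ X ∈ c.lie C, c.exp X = g :=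
  ⟨fun ⟨X, h⟩ => ⟨X.toAdd, X.toAdd.2, h⟩, fun ⟨X, hX, h⟩ => ⟨Multiplicative.ofAdd ⟨X, hX⟩, h⟩⟩

/-- The range contains a neighbourhood of `1` in `C` by `eventually_mem_exp_lie`. It plays the role
of the identity component of `C`. -/
theorem isOpen_range_expHom (hC : IsAbelian C) (hcl : IsClosed (C : Set G)) :
    IsOpen (((expHom (c := c) hC).range.subgroupOf C : Subgroup C) : Set C) := by
  refine Subgroup.isOpen_of_mem_nhds _ (g := 1) ?_
  have h := (continuous_subtype_val.tendsto' (1 : C) (1 : G) rfl).eventually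
    (eventually_mem_exp_lie (c := c) hC hcl one_pos)
  filter_upwards [h] with x hx
  obtain ⟨X, hX, -, h⟩ := hx x.2
  exact (mem_range_expHom hC).mpr ⟨X, hX, h⟩

theorem isClosed_range_expHom (hC : IsAbelian C) (hcl : IsClosed (C : Set G)) :
    IsClosed ((expHom (c := c) hC).range : Set G) := by
  have h1 := Subgroup.isClosed_of_isOpen _ (isOpen_range_expHom (c := c) hC hcl)
  have h2 := hcl.isClosedEmbedding_subtypeVal.isClosedMap _ h1
  convert h2 using 1
  ext g
  constructor
  · intro h
    exact ⟨⟨g, range_expHom_le hC h⟩, h, rfl⟩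
  · rintro ⟨x, hx, rfl⟩
    exact hx

theorem isToral_range_expHom (hC : IsAbelian C) (hcl : IsClosed (C : Set G)) :
    IsToral (expHom (c := c) hC).range where
  isClosed := isClosed_range_expHom hC hcl
  isConnected := by
    have : ConnectedSpace (Multiplicative (c.lie C)) := inferInstanceAs (ConnectedSpace (c.lie C))
    rw [MonoidHom.coe_range]
    exact isConnected_range (continuous_expHom hC)
  isAbelian a ha b hb := hC a (range_expHom_le hC ha) b (range_expHom_le hC hb)

theorem lie_range_expHom (hC : IsAbelian C) : c.lie (expHom (c := c) hC).range = c.lie C := by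
  refine le_antisymm (lie_mono (range_expHom_le hC)) fun X hX => ?_
  exact Submodule.subset_span fun t =>
    (mem_range_expHom hC).mpr ⟨t • X, Submodule.smul_mem _ _ hX, rfl⟩

/-- The range of the exponential map is an open, hence also closed, subgroup of the connected group
`A`. -/
theorem IsToral.exists_exp (h : IsToral A) {a : G} (ha : a ∈ A) : ∃ X ∈ c.lie A, c.exp X = a := by
  have hcon : ConnectedSpace A := isConnected_iff_connectedSpace.mp h.isConnected
  have ho := isOpen_range_expHom (c := c) h.isAbelian h.isClosed
  have hu := IsClopen.eq_univ ⟨Subgroup.isClosed_of_isOpen _ ho, ho⟩ ⟨1, Subgroup.one_mem _⟩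
  have : (⟨a, ha⟩ : A) ∈ (Set.univ : Set A) := trivial
  rw [← hu] at this
  exact (mem_range_expHom h.isAbelian).mp this

theorem IsToral.le_of_lie_le (h : IsToral A) (hB : IsAbelian B) (hle : c.lie A ≤ c.lie B) :
    A ≤ B := by
  intro a ha
  obtain ⟨X, hX, rfl⟩ := IsToral.exists_exp (c := c) h ha
  exact exp_mem hB (hle hX)

/-- The exponential map of a toral subgroup onto it. -/
def expOnto (h : IsAbelian A) : Multiplicative (c.lie A) →* A :=
  (expHom (c := c) h).codRestrict A fun X => exp_mem h X.toAdd.2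

theorem IsToral.isTorusOfDim (h : IsToral A) : IsTorusOfDim A (Module.finrank ℝ (c.lie A)) := by
  have : CompactSpace A := isCompact_iff_compactSpace.mp h.isClosed.isCompact
  obtain ⟨r, hr, hinj⟩ := c.exists_exp_inj
  refine exists_equiv_torus (expOnto (c := c) h.isAbelian)
    ((continuous_expHom h.isAbelian).subtype_mk _) ?_ ⟨r, hr, fun v hv h1 => ?_⟩
  · rintro ⟨a, ha⟩
    obtain ⟨X, hX, rfl⟩ := IsToral.exists_exp (c := c) h ha
    exact ⟨Multiplicative.ofAdd ⟨X, hX⟩, rfl⟩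
  · exact Subtype.ext (hinj v hv (congrArg Subtype.val h1))

end LocalCoord

section

variable {G : Type*} [Group G] {A B H : Subgroup G}

/-- Conjugate of a subgroup. -/
def conjSubgroup (g : G) (A : Subgroup G) : Subgroup G := A.map (MulAut.conj g).toMonoidHom

theorem mem_conjSubgroup {g x : G} : x ∈ conjSubgroup g A ↔ g⁻¹ * x * g ∈ A := by
  constructor
  · rintro ⟨a, ha, rfl⟩
    simpa [mul_assoc] using ha
  · intro h
    exact ⟨_, h, by simp [mul_assoc]⟩

theorem conjSubgroup_mono (g : G) (h : A ≤ B) : conjSubgroup g A ≤ conjSubgroup g B :=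
  Subgroup.map_mono h

theorem conjSubgroup_mul (g h : G) :
    conjSubgroup (g * h) A = conjSubgroup g (conjSubgroup h A) := by
  ext x
  simp [mem_conjSubgroup, mul_assoc]

theorem conjSubgroup_one : conjSubgroup 1 A = A := by
  ext x
  simp [mem_conjSubgroup]

theorem conjSubgroup_le {g : G} (hg : g ∈ H) (h : A ≤ H) : conjSubgroup g A ≤ H := by
  rintro _ ⟨a, ha, rfl⟩
  exact H.mul_mem (H.mul_mem hg (h ha)) (H.inv_mem hg)

end

section

variable {G : Type*} [Group G] [TopologicalSpace G] {A B H : Subgroup G}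

theorem isToral_of_isTorusOfDim [T2Space G] {n : ℕ} (h : IsTorusOfDim A n) : IsToral A := by
  obtain ⟨f⟩ := h
  have hc : CompactSpace A := f.toHomeomorph.symm.compactSpace
  have hcon : ConnectedSpace A := f.symm.surjective.connectedSpace f.symm.continuous
  refine ⟨(isCompact_iff_compactSpace.mpr hc).isClosed, isConnected_iff_connectedSpace.mpr hcon,
    fun a ha b hb => ?_⟩
  have : (⟨a, ha⟩ * ⟨b, hb⟩ : A) = ⟨b, hb⟩ * ⟨a, ha⟩ := f.injective (by
    rw [map_mul, map_mul, mul_comm])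
  exact congrArg Subtype.val this

theorem isTorusOfDim_unique {n m : ℕ} (h : IsTorusOfDim A n) (h' : IsTorusOfDim A m) : n = m := by
  obtain ⟨f⟩ := h
  obtain ⟨g⟩ := h'
  exact torus_dim_unique (f.symm.toMulEquiv.trans g.toMulEquiv)

theorem IsToral.exists_mul [IsTopologicalGroup G] [T2Space G] [CompactSpace G] (hA : IsToral A)
    (hB : IsToral B) (hAB : ∀ a ∈ A, ∀ b ∈ B, a * b = b * a) :
    ∃ J : Subgroup G, IsToral J ∧ A ≤ J ∧ B ≤ J ∧ ∀ H : Subgroup G, A ≤ H → B ≤ H → J ≤ H := by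
  let J : Subgroup G :=
    { carrier := (fun z : G × G => z.1 * z.2) '' ((A : Set G) ×ˢ (B : Set G))
      one_mem' := ⟨(1, 1), ⟨A.one_mem, B.one_mem⟩, one_mul 1⟩
      mul_mem' := by
        rintro _ _ ⟨⟨a, b⟩, ⟨ha, hb⟩, rfl⟩ ⟨⟨a', b'⟩, ⟨ha', hb'⟩, rfl⟩
        refine ⟨(a * a', b * b'), ⟨A.mul_mem ha ha', B.mul_mem hb hb'⟩, ?_⟩
        simp only
        rw [mul_assoc, ← mul_assoc a' b b', hAB a' ha' b hb]
        simp only [mul_assoc]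
      inv_mem' := by
        rintro _ ⟨⟨a, b⟩, ⟨ha, hb⟩, rfl⟩
        refine ⟨(a⁻¹, b⁻¹), ⟨A.inv_mem ha, B.inv_mem hb⟩, ?_⟩
        simp only
        rw [hAB a⁻¹ (A.inv_mem ha) b⁻¹ (B.inv_mem hb), mul_inv_rev] }
  refine ⟨J, ⟨?_, ?_, ?_⟩, fun a ha => ⟨(a, 1), ⟨ha, B.one_mem⟩, mul_one a⟩,
    fun b hb => ⟨(1, b), ⟨A.one_mem, hb⟩, one_mul b⟩, ?_⟩
  · exact ((hA.isClosed.isCompact.prod hB.isClosed.isCompact).image continuous_mul).isClosed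
  · exact (hA.isConnected.prod hB.isConnected).image _ continuous_mul.continuousOn
  · rintro _ ⟨⟨a, b⟩, ⟨ha, hb⟩, rfl⟩ _ ⟨⟨a', b'⟩, ⟨ha', hb'⟩, rfl⟩
    have h1 := hA.isAbelian a ha a' ha'
    have h2 := hB.isAbelian b hb b' hb'
    have h3 := hAB a ha b' hb'
    have h4 := hAB a' ha' b hb
    simp only at *
    calc a * b * (a' * b') = a * (b * a') * b' := by group
      _ = (a * a') * (b * b') := by rw [← h4]; group
      _ = (a' * a) * (b' * b) := by rw [h1, h2]
      _ = a' * (a * b') * b := by group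
      _ = _ := by rw [h3]; group
  · rintro H hAH hBH _ ⟨⟨a, b⟩, ⟨ha, hb⟩, rfl⟩
    exact H.mul_mem (hAH ha) (hBH hb)

theorem isTorusOfDim_conjSubgroup [IsTopologicalGroup G] {n : ℕ} (g : G) (h : IsTorusOfDim A n) :
    IsTorusOfDim (conjSubgroup g A) n := by
  obtain ⟨f⟩ := h
  let e : A ≃* conjSubgroup g A :=
    A.equivMapOfInjective (MulAut.conj g).toMonoidHom (MulAut.conj g).injective
  have he : Continuous e := by
    refine Continuous.subtype_mk (f := fun a : A => g * a * g⁻¹) ?_ _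
    fun_prop
  have hes : Continuous e.symm := by
    have hval : ∀ x, ((e.symm x : A) : G) = g⁻¹ * x * g := by
      intro x
      obtain ⟨a, rfl⟩ := e.surjective x
      rw [MulEquiv.symm_apply_apply]
      change (a : G) = g⁻¹ * (g * a * g⁻¹) * g
      group
    rw [continuous_induced_rng]
    refine Continuous.congr ?_ fun x => (hval x).symm
    fun_prop
  exact ⟨(ContinuousMulEquiv.mk e he hes).symm.trans f⟩

end

/-! ### Generators of tori -/

namespace LocalCoord

variable {E G : Type*} [NormedAddCommGroup E] [NormedSpace ℝ E] [FiniteDimensional ℝ E] [Group G]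
    [TopologicalSpace G] [IsTopologicalGroup G] [T2Space G] [CompactSpace G] (c : LocalCoord E G)
    {A B C H : Subgroup G}

/-- Closedness, connectedness and commutativity can be checked for products and closures, where an
isomorphism with a product of circles is not at hand. -/
theorem isTorus_iff (c : LocalCoord E G) : IsTorus A ↔ IsToral A :=
  ⟨fun ⟨_, h⟩ => isToral_of_isTorusOfDim h, fun h => ⟨_, IsToral.isTorusOfDim (c := c) h⟩⟩

theorem finrank_lie_eq {n : ℕ} (h : IsTorusOfDim A n) : Module.finrank ℝ (c.lie A) = n :=
  isTorusOfDim_unique (IsToral.isTorusOfDim (isToral_of_isTorusOfDim h)) h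

/-- The closure of a one-parameter subgroup is a torus. -/
theorem exists_toral_of_exp (X : E) : ∃ J : Subgroup G, IsToral J ∧ X ∈ c.lie J ∧
    ∀ H : Subgroup G, IsClosed (H : Set G) → (∀ t : ℝ, c.exp (t • X) ∈ H) → J ≤ H := by
  let D : Subgroup G :=
    { carrier := Set.range fun t : ℝ => c.exp (t • X)
      one_mem' := ⟨0, by simp [c.exp_zero]⟩
      mul_mem' := by
        rintro _ _ ⟨s, rfl⟩ ⟨t, rfl⟩
        exact ⟨s + t, (c.isOneParam_exp X).map_add s t⟩
      inv_mem' := by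
        rintro _ ⟨s, rfl⟩
        exact ⟨-s, (c.isOneParam_exp X).map_neg s⟩ }
  have hD : IsAbelian D := by
    rintro _ ⟨s, rfl⟩ _ ⟨t, rfl⟩
    exact (c.isOneParam_exp X).commute s t
  have hcl : IsAbelian D.topologicalClosure := by
    intro a ha b hb
    have h1 : ∀ a ∈ D, ∀ b ∈ closure (D : Set G), a * b = b * a := fun a ha b hb =>
      closure_minimal (fun b hb => hD a ha b hb)
        (isClosed_eq (continuous_const_mul a) (continuous_mul_const a)) hb
    exact closure_minimal (s := (D : Set G)) (fun a ha => h1 a ha b hb)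
      (isClosed_eq (continuous_mul_const b) (continuous_const_mul b)) ha
  refine ⟨D.topologicalClosure, ⟨D.isClosed_topologicalClosure, ?_, hcl⟩, ?_, ?_⟩
  · exact (isConnected_range (c.continuous_exp_smul X)).closure
  · exact Submodule.subset_span fun t => D.le_topologicalClosure ⟨t, rfl⟩
  · intro H hH h
    exact D.topologicalClosure_minimal (by rintro _ ⟨t, rfl⟩; exact h t) hH

theorem lie_eq_span_ker (h : IsToral A) :
    c.lie A = Submodule.span ℝ {v | v ∈ c.lie A ∧ c.exp v = 1} := by
  have : CompactSpace A := isCompact_iff_compactSpace.mp h.isClosed.isCompact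
  have htop := span_ker_eq_top (expOnto (c := c) h.isAbelian)
    ((continuous_expHom h.isAbelian).subtype_mk _) (by
      rintro ⟨a, ha⟩
      obtain ⟨X, hX, rfl⟩ := IsToral.exists_exp (c := c) h ha
      exact ⟨Multiplicative.ofAdd ⟨X, hX⟩, rfl⟩)
  have := congrArg (Submodule.map (c.lie A).subtype) htop
  rw [Submodule.map_top, Submodule.range_subtype, Submodule.map_span] at this
  refine this.symm.trans (congrArg _ ?_)
  ext v
  constructor
  · rintro ⟨w, hw, rfl⟩
    exact ⟨w.2, congrArg Subtype.val hw⟩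
  · rintro ⟨hv, h1⟩
    exact ⟨⟨v, hv⟩, Subtype.ext h1, rfl⟩

theorem countable_ker_exp (h : IsAbelian A) : {v | v ∈ c.lie A ∧ c.exp v = 1}.Countable := by
  obtain ⟨r, hr, hinj⟩ := c.exists_exp_inj
  have : ProperSpace E := FiniteDimensional.proper ℝ E
  have : DiscreteTopology {v | v ∈ c.lie A ∧ c.exp v = 1} := by
    refine DiscreteTopology.of_forall_le_dist hr fun v w hvw => ?_
    by_contra hlt
    rw [not_le, Subtype.dist_eq, dist_eq_norm] at hlt
    refine hvw (Subtype.ext (sub_eq_zero.mp (hinj _ hlt ?_)))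
    rw [sub_eq_add_neg, exp_add h v.2.1 (Submodule.neg_mem _ w.2.1), c.exp_neg, v.2.2, w.2.2,
      inv_one, mul_one]
  exact TopologicalSpace.separableSpace_iff_countable.mp inferInstance

/-- A torus contains a dense one-parameter subgroup. -/
theorem IsToral.exists_generator (h : IsToral A) : ∃ X ∈ c.lie A, ∀ C : Subgroup G,
    IsClosed (C : Set G) → (∀ t : ℝ, c.exp (t • X) ∈ C) → A ≤ C := by
  set Λ : Set E := {v | v ∈ c.lie A ∧ c.exp v = 1} with hΛ
  have hcount : Countable Λ := c.countable_ker_exp h.isAbelian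
  -- A subtorus of `A` has a Lie algebra spanned by finitely many elements of the countable lattice
  -- `Λ`, so there are only countably many proper ones. A vector outside all those proper subspaces
  -- generates `A`.
  let ι := {F : Finset Λ // (Submodule.span ℝ (Subtype.val '' (F : Set Λ))).comap
    (c.lie A).subtype ≠ ⊤}
  obtain ⟨X, hX⟩ := exists_notMem_of_countable (V := c.lie A) (ι := ι)
    (fun F => (Submodule.span ℝ (Subtype.val '' (F.1 : Set Λ))).comap (c.lie A).subtype)
    fun F => F.2
  refine ⟨X, X.2, fun C hC hXC => ?_⟩
  have hab : IsAbelian (C ⊓ A) := fun a ha b hb => h.isAbelian a ha.2 b hb.2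
  have hD := isToral_range_expHom (c := c) hab (hC.inter h.isClosed)
  have hXl : (X : E) ∈ c.lie (C ⊓ A) :=
    Submodule.subset_span fun t => ⟨hXC t, (mem_lie h.isAbelian).mp X.2 t⟩
  have hspan := c.lie_eq_span_ker hD
  rw [lie_range_expHom] at hspan
  have hfg : (Submodule.span ℝ {v | v ∈ c.lie (C ⊓ A) ∧ c.exp v = 1}).FG :=
    Submodule.FG.of_finite
  obtain ⟨F, hF, hFs⟩ := (Submodule.fg_span_iff_fg_span_finset_subset _).mp hfg
  rw [← hspan] at hFs
  have hle : c.lie (C ⊓ A) ≤ c.lie A := lie_mono inf_le_right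
  classical
  let F' : Finset Λ := F.subtype (· ∈ Λ)
  have hF' : Subtype.val '' (F' : Set Λ) = (F : Set E) := by
    ext v
    simp only [F', Set.mem_image, Finset.mem_coe, Finset.mem_subtype, Subtype.exists,
      exists_and_right, exists_eq_right]
    exact ⟨fun ⟨_, h⟩ => h, fun hv => ⟨⟨hle (hF hv).1, (hF hv).2⟩, hv⟩⟩
  have htop : (Submodule.span ℝ (Subtype.val '' (F' : Set Λ))).comap (c.lie A).subtype = ⊤ := by
    by_contra hne
    refine hX ⟨F', hne⟩ ?_
    simp only [Submodule.mem_comap, hF', ← hFs]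
    exact hXl
  rw [hF', ← hFs] at htop
  refine (IsToral.le_of_lie_le (c := c) h hab fun v hv => ?_).trans inf_le_left
  have : (⟨v, hv⟩ : c.lie A) ∈ (⊤ : Submodule ℝ (c.lie A)) := trivial
  rwa [← htop] at this

end LocalCoord
-- Lie bracket, adjoint representation, invariant inner product
namespace LocalCoord

section Bracket

variable {E G : Type*} [NormedAddCommGroup E] [NormedSpace ℝ E] [Group G]
    [TopologicalSpace G] (c : LocalCoord E G)

/-- The Lie bracket. -/
def bracket : E →L[ℝ] E →L[ℝ] E := mixedDeriv fun z : E × E => c.commC z.1 z.2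

theorem commC_zero_left (v : E) : c.commC 0 v = 0 := by
  simp [commC, c.point_zero, c.coord_one]

theorem commC_zero_right (v : E) : c.commC v 0 = 0 := by
  simp [commC, c.point_zero, c.coord_one]

theorem tendsto_comm_point [IsTopologicalGroup G] :
    Tendsto (fun z : E × E => c.point z.1 * c.point z.2 * (c.point z.1)⁻¹ * (c.point z.2)⁻¹)
      (𝓝 0) (𝓝 1) := by
  have h1 := c.tendsto_point.comp (continuous_fst.tendsto' (0 : E × E) 0 rfl)
  have h2 := c.tendsto_point.comp (continuous_snd.tendsto' (0 : E × E) 0 rfl)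
  simpa using ((h1.mul h2).mul h1.inv).mul h2.inv

theorem eventually_point_commC [IsTopologicalGroup G] : ∀ᶠ z : E × E in 𝓝 0,
    c.point (c.commC z.1 z.2) = c.point z.1 * c.point z.2 * (c.point z.1)⁻¹ * (c.point z.2)⁻¹ :=
  c.tendsto_comm_point.eventually c.point_coord

theorem tendsto_commC [IsTopologicalGroup G] :
    Tendsto (fun z : E × E => c.commC z.1 z.2) (𝓝 0) (𝓝 0) :=
  c.tendsto_coord.comp c.tendsto_comm_point

theorem tendsto_zero_of_inv_smul {s : ℕ → ℝ} (hs : ∀ n, s n ≠ 0) (hs0 : Tendsto s atTop (𝓝 0))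
    {x : ℕ → E} {X : E} (hx : Tendsto (fun n => (s n)⁻¹ • x n) atTop (𝓝 X)) :
    Tendsto x atTop (𝓝 0) := by
  have := hs0.smul hx
  rw [zero_smul] at this
  exact this.congr fun n => smul_inv_smul₀ (hs n) _

theorem exists_commC_approx {ε : ℝ} (hε : 0 < ε) : ∃ δ > 0, ∀ a b : E, ‖a‖ < δ → ‖b‖ < δ →
    ‖c.commC a b - c.bracket a b‖ ≤ ε * ‖a‖ * ‖b‖ := by
  obtain ⟨δ, hδ, H⟩ := exists_bilinear_approx (f := fun z : E × E => c.commC z.1 z.2)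
    c.contDiffAt_comm (Eventually.of_forall c.commC_zero_left) hε
  refine ⟨δ, hδ, fun a b ha hb => ?_⟩
  have := H a b 0 ha hb (by simpa using hδ)
  simp only [c.commC_zero_right, sub_zero] at this
  exact this

/-- Expresses the bracket as a limit of rescaled commutators, so that identities between commutators
pass to the bracket. -/
theorem tendsto_commC_div {s : ℕ → ℝ} (hs : ∀ n, s n ≠ 0) (hs0 : Tendsto s atTop (𝓝 0))
    {x y : ℕ → E} {X Y : E} (hx : Tendsto (fun n => (s n)⁻¹ • x n) atTop (𝓝 X))
    (hy : Tendsto (fun n => (s n)⁻¹ • y n) atTop (𝓝 Y)) :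
    Tendsto (fun n => ((s n)⁻¹ * (s n)⁻¹) • c.commC (x n) (y n)) atTop
      (𝓝 (c.bracket X Y)) := by
  have hx0 := tendsto_zero_of_inv_smul hs hs0 hx
  have hy0 := tendsto_zero_of_inv_smul hs hs0 hy
  have h1 : Tendsto (fun n => ((s n)⁻¹ * (s n)⁻¹) • c.bracket (x n) (y n)) atTop
      (𝓝 (c.bracket X Y)) := by
    have hc : Continuous fun z : E × E => c.bracket z.1 z.2 := by fun_prop
    refine ((hc.tendsto (X, Y)).comp (hx.prodMk_nhds hy)).congr fun n => ?_
    simp only [Function.comp_apply, map_smul, smul_apply, smul_smul]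
  have h2 : Tendsto (fun n => ((s n)⁻¹ * (s n)⁻¹) •
      (c.commC (x n) (y n) - c.bracket (x n) (y n))) atTop (𝓝 0) := by
    have hprod := (hx.norm).mul (hy.norm)
    obtain ⟨M, hMpos, hM⟩ : ∃ M > 0, ‖X‖ * ‖Y‖ < M := ⟨‖X‖ * ‖Y‖ + 1, by positivity, by linarith⟩
    refine Metric.tendsto_nhds.mpr fun ε hε => ?_
    obtain ⟨δ, hδ, H⟩ := c.exists_commC_approx (ε := ε / M) (by positivity)
    have hn0 : ∀ {z : ℕ → E}, Tendsto z atTop (𝓝 0) → ∀ᶠ n in atTop, ‖z n‖ < δ := fun {z} hz => by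
      have := hz.norm
      rw [norm_zero] at this
      exact this.eventually (gt_mem_nhds hδ)
    filter_upwards [hn0 hx0, hn0 hy0, hprod.eventually (gt_mem_nhds hM)] with n a b hab
    rw [dist_zero_right, norm_smul, norm_mul]
    rw [norm_smul, norm_smul] at hab
    calc _ ≤ ‖(s n)⁻¹‖ * ‖(s n)⁻¹‖ * (ε / M * ‖x n‖ * ‖y n‖) := by gcongr; exact H _ _ a b
      _ = ε / M * (‖(s n)⁻¹‖ * ‖x n‖ * (‖(s n)⁻¹‖ * ‖y n‖)) := by ring
      _ < ε / M * M := by gcongr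
      _ = ε := by field_simp
  refine (zero_add (c.bracket X Y) ▸ h2.add h1).congr fun n => ?_
  rw [← smul_add, sub_add_cancel]

theorem exists_tendsto_zero_ne :
    ∃ s : ℕ → ℝ, (∀ n, s n ≠ 0) ∧ Tendsto s atTop (𝓝 0) :=
  ⟨_, fun n => by positivity, tendsto_one_div_add_atTop_nhds_zero_nat⟩

theorem tendsto_inv_smul_smul {s : ℕ → ℝ} (hs : ∀ n, s n ≠ 0) (X : E) :
    Tendsto (fun n => (s n)⁻¹ • s n • X) atTop (𝓝 X) :=
  tendsto_const_nhds.congr fun n => (inv_smul_smul₀ (hs n) X).symm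

/-- Exchanging the two entries inverts a commutator, and inversion has derivative `-id`. -/
theorem bracket_antisymm [IsTopologicalGroup G] (X Y : E) : c.bracket Y X = -c.bracket X Y := by
  obtain ⟨s, hs, hs0⟩ := exists_tendsto_zero_ne
  have hX := tendsto_inv_smul_smul hs X
  have hY := tendsto_inv_smul_smul hs Y
  have h1 := c.tendsto_commC_div hs hs0 hX hY
  have h2 := c.tendsto_commC_div hs hs0 hY hX
  have hz : Tendsto (fun n => ((s n • X, s n • Y) : E × E)) atTop (𝓝 0) :=
    (tendsto_zero_of_inv_smul hs hs0 hX).prodMk_nhds (tendsto_zero_of_inv_smul hs hs0 hY)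
  have h3 := (c.hasFDerivAt_invC.hasFDerivWithinAt (s := Set.univ)).lim
    (c.tendsto_commC.comp hz) (by simp) h1
  refine tendsto_nhds_unique h2 ?_
  simp only [neg_apply, ContinuousLinearMap.id_apply] at h3
  refine h3.congr' ?_
  filter_upwards [hz.eventually c.eventually_point_commC] with n hn
  congr 1
  simp only [Function.comp_apply, zero_add]
  have h0 : c.invC 0 = 0 := by simp [invC, c.point_zero, c.coord_one]
  rw [h0, sub_zero, invC, hn, commC]
  congr 1
  group

theorem map_bracket [IsTopologicalGroup G] {f : G →* G} {L : E →L[ℝ] E} (hf : ContinuousAt f 1)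
    (hL : HasFDerivAt (fun u => c.coord (f (c.point u))) L 0) (X Y : E) :
    L (c.bracket X Y) = c.bracket (L X) (L Y) := by
  obtain ⟨s, hs, hs0⟩ := exists_tendsto_zero_ne
  set F : E → E := fun u => c.coord (f (c.point u)) with hF
  have hF0 : F 0 = 0 := by simp [hF, c.point_zero, c.coord_one]
  have hX := tendsto_inv_smul_smul hs X
  have hY := tendsto_inv_smul_smul hs Y
  have hX0 := tendsto_zero_of_inv_smul hs hs0 hX
  have hY0 := tendsto_zero_of_inv_smul hs hs0 hY
  have hz : Tendsto (fun n => ((s n • X, s n • Y) : E × E)) atTop (𝓝 0) :=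
    hX0.prodMk_nhds hY0
  have hlim : ∀ {d : ℕ → E} {t : ℕ → ℝ} {W : E}, Tendsto d atTop (𝓝 0) →
      Tendsto (fun n => t n • d n) atTop (𝓝 W) →
      Tendsto (fun n => t n • F (d n)) atTop (𝓝 (L W)) := by
    intro d t W hd hW
    have := (hL.hasFDerivWithinAt (s := Set.univ)).lim hd (by simp) hW
    simpa [hF0, ← hF, c.point_zero, c.coord_one] using this
  have h1 := hlim (c.tendsto_commC.comp hz) (c.tendsto_commC_div hs hs0 hX hY)
  have h2 := c.tendsto_commC_div hs hs0 (hlim hX0 hX) (hlim hY0 hY)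
  refine tendsto_nhds_unique h1 (h2.congr' ?_)
  have hp : ∀ {d : ℕ → E}, Tendsto d atTop (𝓝 0) →
      ∀ᶠ n in atTop, c.point (F (d n)) = f (c.point (d n)) := fun {d} hd => by
    have : Tendsto (fun n => f (c.point (d n))) atTop (𝓝 1) := by
      have := hf.tendsto.comp (c.tendsto_point.comp hd)
      rwa [map_one] at this
    exact this.eventually c.point_coord
  filter_upwards [hz.eventually c.eventually_point_commC, hp hX0, hp hY0] with n h3 h4 h5
  congr 1
  rw [commC, h4, h5]
  change _ = c.coord (f (c.point (c.commC (s n • X) (s n • Y))))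
  rw [h3]
  simp

/-- The adjoint representation. -/
def Ad (g : G) : E →L[ℝ] E := fderiv ℝ (fun u => c.coord (g * c.point u * g⁻¹)) 0

theorem hasFDerivAt_conj (g : G) :
    HasFDerivAt (fun u => c.coord (MulAut.conj g (c.point u))) (c.Ad g) 0 :=
  (c.differentiableAt_conj g).hasFDerivAt

theorem continuousAt_conj [IsTopologicalGroup G] (g : G) :
    ContinuousAt (MulAut.conj g).toMonoidHom 1 := by
  have : Continuous fun x : G => g * x * g⁻¹ := by fun_prop
  exact this.continuousAt

theorem Ad_bracket [IsTopologicalGroup G] (g : G) (X Y : E) :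
    c.Ad g (c.bracket X Y) = c.bracket (c.Ad g X) (c.Ad g Y) :=
  c.map_bracket (continuousAt_conj g) (c.hasFDerivAt_conj g) X Y

/-- Conjugation is commutator times identity, `u v u⁻¹ = (u v u⁻¹ v⁻¹) v`. Hence `Ad (point u)` is
`id` plus the derivative of the commutator in `v`, and deriving once more in `u` gives the mixed
derivative. -/
theorem hasFDerivAt_Ad_point [IsTopologicalGroup G] :
    HasFDerivAt (fun u => c.Ad (c.point u)) c.bracket 0 := by
  set f : E × E → E := fun z => c.commC z.1 z.2 with hf
  have hfc : ContDiffAt ℝ 2 f 0 := c.contDiffAt_comm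
  have hP := ((contDiffAt_partial hfc).differentiableAt (by norm_num)).hasFDerivAt
  have hP' : HasFDerivAt (fun u : E => (fderiv ℝ f (u, 0)).comp (ContinuousLinearMap.inr ℝ E E))
      c.bracket 0 :=
    HasFDerivAt.comp (g := fun z => (fderiv ℝ f z).comp (ContinuousLinearMap.inr ℝ E E))
      (f := fun u : E => (u, (0 : E))) (0 : E) hP (hasFDerivAt_prodMk_left (0 : E) (0 : E))
  refine (hP'.add_const (ContinuousLinearMap.id ℝ E)).congr_of_eventuallyEq ?_
  have hu : Tendsto (fun u : E => ((u, 0) : E × E)) (𝓝 0) (𝓝 0) :=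
    Continuous.tendsto' (by fun_prop) _ _ rfl
  filter_upwards [hu.eventually (eventually_differentiableAt hfc)] with u hd
  have h1 : HasFDerivAt (fun v : E => c.commC u v)
      ((fderiv ℝ f (u, 0)).comp (ContinuousLinearMap.inr ℝ E E)) 0 :=
    HasFDerivAt.comp (g := f) (f := fun v : E => (u, v)) (0 : E) hd.hasFDerivAt
      (hasFDerivAt_prodMk_right u (0 : E))
  have h2 := HasFDerivAt.comp (g := fun z : E × E => c.mulC z.1 z.2)
    (f := fun v : E => (c.commC u v, v)) (g' := ContinuousLinearMap.fst ℝ E E +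
      ContinuousLinearMap.snd ℝ E E) (0 : E)
    (by rw [c.commC_zero_right]; exact c.hasStrictFDerivAt_mulC.hasFDerivAt)
    (h1.prodMk (hasFDerivAt_id (0 : E)))
  have h3 : HasFDerivAt (fun v => c.coord (c.point u * c.point v * (c.point u)⁻¹))
      ((fderiv ℝ f (u, 0)).comp (ContinuousLinearMap.inr ℝ E E) + ContinuousLinearMap.id ℝ E)
      0 := by
    refine (h2.congr_of_eventuallyEq ?_).congr_fderiv (by ext v; simp)
    have ht : Tendsto (fun v => c.point u * c.point v * (c.point u)⁻¹ * (c.point v)⁻¹)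
        (𝓝 0) (𝓝 1) := by
      simpa using (((tendsto_const_nhds (x := c.point u)).mul c.tendsto_point).mul
        (tendsto_const_nhds (x := (c.point u)⁻¹))).mul c.tendsto_point_inv
    filter_upwards [ht.eventually c.point_coord] with v hv
    simp only [Function.comp_apply, mulC, commC, hv]
    congr 1
    group
  exact h3.fderiv

end Bracket

variable {E G : Type*} [NormedAddCommGroup E] [NormedSpace ℝ E] [FiniteDimensional ℝ E] [Group G]
    [TopologicalSpace G] [IsTopologicalGroup G] [T2Space G] [CompactSpace G] (c : LocalCoord E G)

theorem map_exp {f : G →* G} {L : E →L[ℝ] E} (hf : ContinuousAt f 1)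
    (hL : HasFDerivAt (fun u => c.coord (f (c.point u))) L 0) (X : E) :
    f (c.exp X) = c.exp (L X) := by
  simpa using ((c.isOneParam_exp X).map hf hL).eq_exp 1

theorem exp_Ad (g : G) (X : E) : c.exp (c.Ad g X) = g * c.exp X * g⁻¹ :=
  (c.map_exp (continuousAt_conj g) (c.hasFDerivAt_conj g) X).symm

theorem eq_of_exp_smul_eq {X Y : E} (h : ∀ t : ℝ, c.exp (t • X) = c.exp (t • Y)) : X = Y := by
  have h1 := (c.isOneParam_exp X).hasDerivAt
  simp only [h] at h1
  exact h1.unique (c.isOneParam_exp Y).hasDerivAt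

theorem Ad_mul (g h : G) (X : E) : c.Ad (g * h) X = c.Ad g (c.Ad h X) := by
  refine c.eq_of_exp_smul_eq fun t => ?_
  simp only [← map_smul, exp_Ad]
  group

theorem Ad_one (X : E) : c.Ad 1 X = X := by
  refine c.eq_of_exp_smul_eq fun t => ?_
  simp only [← map_smul, exp_Ad]
  group

theorem Ad_eq_self_iff (g : G) (X : E) :
    c.Ad g X = X ↔ ∀ t : ℝ, g * c.exp (t • X) = c.exp (t • X) * g := by
  constructor
  · intro h t
    rw [← mul_inv_eq_iff_eq_mul, ← exp_Ad, map_smul, h]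
  · intro h
    refine c.eq_of_exp_smul_eq fun t => ?_
    rw [← map_smul, exp_Ad, mul_inv_eq_iff_eq_mul, h]

theorem continuous_Ad : Continuous c.Ad := by
  have h1 : ContinuousAt c.Ad 1 := by
    have h2 : ContinuousAt (fun u => c.Ad (c.point u)) 0 := c.hasFDerivAt_Ad_point.continuousAt
    have h3 := h2.tendsto.comp c.tendsto_coord
    rw [c.point_zero] at h3
    exact h3.congr' (c.point_coord.mono fun g hg => by simp [hg])
  rw [continuous_iff_continuousAt]
  intro g
  have h2 : Tendsto (fun h => (c.Ad g).comp (c.Ad (g⁻¹ * h))) (𝓝 g) (𝓝 ((c.Ad g).comp (c.Ad 1))) := by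
    refine ((ContinuousLinearMap.compL ℝ E E E (c.Ad g)).continuous.tendsto _).comp
      (h1.tendsto.comp ?_)
    exact (continuous_const_mul g⁻¹).tendsto' _ _ (by simp)
  have e : ∀ h, (c.Ad g).comp (c.Ad (g⁻¹ * h)) = c.Ad h := fun h => by
    ext X
    rw [ContinuousLinearMap.comp_apply, ← c.Ad_mul, mul_inv_cancel_left]
  have e1 : (c.Ad g).comp (c.Ad 1) = c.Ad g := by
    ext X
    rw [ContinuousLinearMap.comp_apply, Ad_one]
  rw [e1] at h2
  exact h2.congr e

theorem hasDerivAt_Ad_exp_zero (Z X : E) :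
    HasDerivAt (fun t : ℝ => c.Ad (c.exp (t • Z)) X) (c.bracket Z X) 0 := by
  have h := c.isOneParam_exp Z
  have h1 := HasFDerivAt.comp_hasDerivAt_of_eq (0 : ℝ) c.hasFDerivAt_Ad_point h.hasDerivAt
    (by simp [c.exp_zero, c.coord_one])
  have h2 := h1.clm_apply (hasDerivAt_const (0 : ℝ) X)
  refine (h2.congr_of_eventuallyEq ?_).congr_deriv (by simp)
  filter_upwards [h.tendsto.eventually c.point_coord] with t ht
  simp [ht]

theorem hasDerivAt_Ad_exp (Z X : E) (t : ℝ) :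
    HasDerivAt (fun t : ℝ => c.Ad (c.exp (t • Z)) X) (c.Ad (c.exp (t • Z)) (c.bracket Z X)) t := by
  have h1 := (c.Ad (c.exp (t • Z))).hasFDerivAt.comp_hasDerivAt (0 : ℝ)
    (c.hasDerivAt_Ad_exp_zero Z X)
  have h2 : HasDerivAt (fun s : ℝ => s - t) 1 t := (hasDerivAt_id t).sub_const t
  have h3 := HasDerivAt.scomp_of_eq t h1 h2 (by simp)
  rw [one_smul] at h3
  refine h3.congr_of_eventuallyEq (Eventually.of_forall fun s => ?_)
  simp only [Function.comp_apply]
  rw [← c.Ad_mul, ← (c.isOneParam_exp Z).map_add]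
  congr 3
  ring_nf

/-- The one-parameter subgroups of `X` and `Y` commute iff the bracket vanishes. -/
theorem bracket_eq_zero_iff (X Y : E) : c.bracket X Y = 0 ↔
    ∀ s t : ℝ, c.exp (s • X) * c.exp (t • Y) = c.exp (t • Y) * c.exp (s • X) := by
  constructor
  · intro h s
    rw [← Ad_eq_self_iff]
    have hd : ∀ t : ℝ, HasDerivAt (fun t : ℝ => c.Ad (c.exp (t • X)) Y) 0 t := fun t => by
      simpa [h] using c.hasDerivAt_Ad_exp X Y t
    have := is_const_of_deriv_eq_zero (fun t => (hd t).differentiableAt) (fun t => (hd t).deriv) s 0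
    simpa [c.exp_zero, c.Ad_one] using this
  · intro h
    have h1 := c.hasDerivAt_Ad_exp_zero X Y
    have : (fun t : ℝ => c.Ad (c.exp (t • X)) Y) = fun _ => Y :=
      funext fun s => (c.Ad_eq_self_iff _ _).mpr (h s)
    rw [this] at h1
    exact h1.unique (hasDerivAt_const (0 : ℝ) Y)

/-- A Euclidean inner product is averaged over Haar measure. The inverse in the integrand turns
invariance under `Ad g` into left invariance of the measure. -/
theorem exists_invariant_form : ∃ B : E →L[ℝ] E →L[ℝ] ℝ, (∀ X Y, B X Y = B Y X) ∧
    (∀ X, B X X = 0 → X = 0) ∧ ∀ g X Y, B (c.Ad g X) (c.Ad g Y) = B X Y := by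
  borelize G
  let μ : MeasureTheory.Measure G := MeasureTheory.Measure.haar
  let F : E → E → G → ℝ := fun X Y g => inner ℝ (toEuclidean (c.Ad g⁻¹ X)) (toEuclidean (c.Ad g⁻¹ Y))
  have hF : ∀ X Y, Continuous (F X Y) := by
    have hA : ∀ X, Continuous fun g : G => toEuclidean (c.Ad g⁻¹ X) := fun X =>
      toEuclidean.continuous.comp
        ((c.continuous_Ad.comp continuous_inv).clm_apply continuous_const)
    exact fun X Y => (hA X).inner (hA Y)
  have hint : ∀ X Y, MeasureTheory.Integrable (F X Y) μ := fun X Y =>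
    (hF X Y).integrable_of_hasCompactSupport (HasCompactSupport.of_compactSpace _)
  let L : E →ₗ[ℝ] E →ₗ[ℝ] ℝ := LinearMap.mk₂ ℝ (fun X Y => ∫ g, F X Y g ∂μ)
    (fun X X' Y => by
      rw [← MeasureTheory.integral_add (hint _ _) (hint _ _)]
      simp only [F, map_add, inner_add_left])
    (fun a X Y => by
      rw [smul_eq_mul, ← MeasureTheory.integral_const_mul]
      simp only [F, map_smul, real_inner_smul_left])
    (fun X Y Y' => by
      rw [← MeasureTheory.integral_add (hint _ _) (hint _ _)]
      simp only [F, map_add, inner_add_right])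
    (fun a X Y => by
      rw [smul_eq_mul, ← MeasureTheory.integral_const_mul]
      simp only [F, map_smul, real_inner_smul_right])
  have hL : ∀ X Y, L.toContinuousBilinearMap X Y = ∫ g, F X Y g ∂μ := fun X Y => rfl
  refine ⟨L.toContinuousBilinearMap, fun X Y => ?_, fun X hX => ?_, fun g X Y => ?_⟩
  · rw [hL, hL]
    congr 1
    funext g
    exact real_inner_comm _ _
  · rw [hL] at hX
    by_contra hne
    have hpos := (hF X X).integral_pos_of_hasCompactSupport_nonneg_nonzero (μ := μ) (x := 1)
      (HasCompactSupport.of_compactSpace _) (fun g => real_inner_self_nonneg) (by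
        simp only [F, inv_one, c.Ad_one]
        rw [inner_self_ne_zero]
        simpa using hne)
    exact hpos.ne' hX
  · rw [hL, hL, ← MeasureTheory.integral_mul_left_eq_self (F X Y) g⁻¹]
    congr 1
    funext h
    simp only [F, mul_inv_rev, inv_inv, c.Ad_mul]

/-- Invariance is differentiated along the one-parameter subgroup of `Z`. -/
theorem invariant_form_bracket {B : E →L[ℝ] E →L[ℝ] ℝ}
    (hB : ∀ g X Y, B (c.Ad g X) (c.Ad g Y) = B X Y) (Z X Y : E) :
    B (c.bracket Z X) Y + B X (c.bracket Z Y) = 0 := by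
  have h1 := (B.hasFDerivAt.comp_hasDerivAt (0 : ℝ) (c.hasDerivAt_Ad_exp_zero Z X)).clm_apply
    (c.hasDerivAt_Ad_exp_zero Z Y)
  have h2 : HasDerivAt (fun _ : ℝ => B X Y) _ 0 :=
    h1.congr_of_eventuallyEq (Eventually.of_forall fun t => (hB (c.exp (t • Z)) X Y).symm)
  have := h2.unique (hasDerivAt_const (0 : ℝ) _)
  simpa [c.exp_zero, c.Ad_one] using this

end LocalCoord
-- Conjugacy of tori in `K`, and the maximal torus of `G` above one of `K`
namespace LocalCoord

variable {E G : Type*} [NormedAddCommGroup E] [NormedSpace ℝ E] [FiniteDimensional ℝ E] [Group G]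
    [TopologicalSpace G] [IsTopologicalGroup G] [T2Space G] [CompactSpace G] (c : LocalCoord E G)
    {A D : Subgroup G}

/-- The one-parameter subgroup of `X` is not contained in a closed subgroup smaller than `A`. -/
def IsGenerator (A : Subgroup G) (X : E) : Prop :=
  ∀ C : Subgroup G, IsClosed (C : Set G) → (∀ t : ℝ, c.exp (t • X) ∈ C) → A ≤ C

variable {c}

theorem IsGenerator.conj {X : E} (h : c.IsGenerator A X) (g : G) :
    c.IsGenerator (conjSubgroup g A) (c.Ad g X) := by
  intro C hC hX
  have hcl : IsClosed (conjSubgroup g⁻¹ C : Set G) := by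
    have : (conjSubgroup g⁻¹ C : Set G) = (fun x => g * x * g⁻¹) ⁻¹' C := by
      ext x
      simp [mem_conjSubgroup]
    rw [this]
    exact hC.preimage (by fun_prop)
  have := h _ hcl fun t => by
    have := hX t
    rw [← map_smul, exp_Ad] at this
    simpa [mem_conjSubgroup] using this
  intro x hx
  rw [mem_conjSubgroup] at hx
  have := mem_conjSubgroup.mp (this hx)
  simpa [mul_assoc] using this

theorem isClosed_centralizer (s : Set G) : IsClosed (Subgroup.centralizer s : Set G) :=
  Set.isClosed_centralizer s

/-- Centralizers are closed, so commutation spreads from the one-parameter subgroups first to `A`,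
then to `D`. -/
theorem commute_of_bracket_eq_zero {X Y : E} (hX : c.IsGenerator A X) (hY : c.IsGenerator D Y)
    (h : c.bracket X Y = 0) : ∀ a ∈ A, ∀ d ∈ D, a * d = d * a := by
  have h0 := (c.bracket_eq_zero_iff X Y).mp h
  have h1 := hX (Subgroup.centralizer (Set.range fun t : ℝ => c.exp (t • Y)))
    (isClosed_centralizer _) fun s => by
      rw [Subgroup.mem_centralizer_iff]
      rintro _ ⟨t, rfl⟩
      exact (h0 s t).symm
  have h2 := hY (Subgroup.centralizer (A : Set G)) (isClosed_centralizer _) fun t => by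
    rw [Subgroup.mem_centralizer_iff]
    intro a ha
    exact ((Subgroup.mem_centralizer_iff.mp (h1 ha)) _ ⟨t, rfl⟩).symm
  exact fun a ha d hd => Subgroup.mem_centralizer_iff.mp (h2 hd) a ha

variable (c) in
/-- `K` is a closed subgroup lying between the group of fixed points of the involution `σ`, with
differential `L`, and its identity component. -/
structure IsFixedPair (σ : G →* G) (L : E →L[ℝ] E) (K : Subgroup G) : Prop where
  continuousAt : ContinuousAt σ 1
  hasFDerivAt : HasFDerivAt (fun u => c.coord (σ (c.point u))) L 0
  involutive : ∀ x, σ (σ x) = x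
  isClosed : IsClosed (K : Set G)
  component_subset : connectedComponentIn {x : G | σ x = x} 1 ⊆ (K : Set G)
  fixed : ∀ k ∈ K, σ k = k

-- With the identity as involution, the results on `K` apply to `G` itself.
variable (c) in
theorem isFixedPair_id : c.IsFixedPair (MonoidHom.id G) (ContinuousLinearMap.id ℝ E) ⊤ where
  continuousAt := continuousAt_id
  hasFDerivAt := (hasFDerivAt_id (0 : E)).congr_of_eventuallyEq c.coord_point
  involutive _ := rfl
  isClosed := isClosed_univ
  component_subset _ _ := trivial
  fixed _ _ := rfl

namespace IsFixedPair

variable {σ : G →* G} {L : E →L[ℝ] E} {K : Subgroup G} (h : c.IsFixedPair σ L K)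
include h

theorem map_exp (X : E) : σ (c.exp X) = c.exp (L X) := c.map_exp h.continuousAt h.hasFDerivAt X

theorem map_bracket (X Y : E) : L (c.bracket X Y) = c.bracket (L X) (L Y) :=
  c.map_bracket h.continuousAt h.hasFDerivAt X Y

theorem apply_apply (X : E) : L (L X) = X := by
  refine c.eq_of_exp_smul_eq fun t => ?_
  rw [← map_smul, ← map_smul, ← h.map_exp, ← h.map_exp, h.involutive]

/-- A one-parameter subgroup of fixed points is connected and contains `1`, so it lies in the
component contained in `K`. Thus the fixed space of `L` serves as the Lie algebra of `K`. -/
theorem apply_eq_iff (X : E) : L X = X ↔ ∀ t : ℝ, c.exp (t • X) ∈ K := by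
  constructor
  · intro hX t
    refine h.component_subset ?_
    have hpre : IsPreconnected (Set.range fun t : ℝ => c.exp (t • X)) :=
      isPreconnected_range (c.continuous_exp_smul X)
    refine hpre.subset_connectedComponentIn ⟨0, by simp [c.exp_zero]⟩ ?_ ⟨t, rfl⟩
    rintro _ ⟨s, rfl⟩
    change σ _ = _
    rw [h.map_exp, map_smul, hX]
  · intro hX
    refine c.eq_of_exp_smul_eq fun t => ?_
    rw [← map_smul, ← h.map_exp, h.fixed _ (hX t)]

theorem apply_eq_of_mem_lie (hA : IsAbelian A) (hAK : A ≤ K) {X : E} (hX : X ∈ c.lie A) :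
    L X = X :=
  (h.apply_eq_iff X).mpr fun t => hAK ((mem_lie hA).mp hX t)

theorem apply_Ad {g : G} (hg : g ∈ K) (X : E) : L (c.Ad g X) = c.Ad g (L X) := by
  refine c.eq_of_exp_smul_eq fun t => ?_
  rw [← map_smul, ← h.map_exp, ← map_smul, exp_Ad, map_mul, map_mul, h.map_exp, map_inv,
    h.fixed g hg, ← map_smul, ← map_smul, exp_Ad]

/-- Two tori of `K` commute after conjugating one of them by an element of `K`. -/
theorem exists_conj_commute (hD : IsToral D) (hA : IsToral A) (hDK : D ≤ K) (hAK : A ≤ K) :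
    ∃ k ∈ K, ∀ x ∈ conjSubgroup k D, ∀ a ∈ A, x * a = a * x := by
  obtain ⟨X, hXD, hX⟩ := IsToral.exists_generator c hD
  obtain ⟨Y, hYA, hY⟩ := IsToral.exists_generator c hA
  obtain ⟨B, hsymm, hdef, hinv⟩ := c.exists_invariant_form
  -- At a maximum the derivative along `Z = [Ad k X, Y]` vanishes; this direction is tangent to `K`
  -- because `L Z = Z`. By invariance of `B` the derivative is `B Z Z` up to sign, so `Z = 0`.
  obtain ⟨k, hk, hmax⟩ := h.isClosed.isCompact.exists_isMaxOn ⟨1, K.one_mem⟩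
    (f := fun g => B (c.Ad g X) Y)
    ((B.continuous.comp (c.continuous_Ad.clm_apply continuous_const)).clm_apply
      continuous_const).continuousOn
  refine ⟨k, hk, commute_of_bracket_eq_zero (IsGenerator.conj hX k) hY ?_⟩
  have hLX : L (c.Ad k X) = c.Ad k X := by
    rw [h.apply_Ad hk, h.apply_eq_of_mem_lie hD.isAbelian hDK hXD]
  have hLY : L Y = Y := h.apply_eq_of_mem_lie hA.isAbelian hAK hYA
  set X' := c.Ad k X with hX'
  set Z := c.bracket X' Y with hZ
  have hLZ : L Z = Z := by rw [hZ, h.map_bracket, hLX, hLY]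
  have hder : HasDerivAt (fun t : ℝ => B (c.Ad (c.exp (t • Z)) X') Y) (B (c.bracket Z X') Y) 0 := by
    have h1 := (B.hasFDerivAt.comp_hasDerivAt (0 : ℝ) (c.hasDerivAt_Ad_exp_zero Z X')).clm_apply
      (hasDerivAt_const (0 : ℝ) Y)
    simpa using h1
  have hloc : IsLocalMax (fun t : ℝ => B (c.Ad (c.exp (t • Z)) X') Y) 0 := by
    refine Eventually.of_forall fun t => ?_
    have := hmax (K.mul_mem ((h.apply_eq_iff Z).mp hLZ t) hk)
    simp only [Set.mem_ofPred_eq, c.Ad_mul] at this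
    simpa [c.exp_zero, c.Ad_one] using this
  have h0 := hloc.hasDerivAt_eq_zero hder
  have h1 := c.invariant_form_bracket hinv X' Z Y
  rw [c.bracket_antisymm X' Z, map_neg, neg_apply, neg_eq_zero] at h0
  rw [h0, zero_add] at h1
  exact hdef _ h1

/-- Every torus of `K` is conjugate in `K` to a subgroup of a given maximal torus. -/
theorem exists_conj_le (hD : IsToral D) (hDK : D ≤ K) (hA : IsMaximalTorus K A) :
    ∃ k ∈ K, conjSubgroup k D ≤ A := by
  have hAt : IsToral A := (isTorus_iff c).mp hA.prop.2
  obtain ⟨k, hk, hcomm⟩ := h.exists_conj_commute hD hAt hDK hA.prop.1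
  obtain ⟨n, hn⟩ := (isTorus_iff c).mpr hD
  have hD' : IsToral (conjSubgroup k D) :=
    isToral_of_isTorusOfDim (isTorusOfDim_conjSubgroup k hn)
  obtain ⟨J, hJ, hDJ, hAJ, hJle⟩ := hD'.exists_mul hAt hcomm
  have hJK : J ≤ K := hJle K (conjSubgroup_le hk hDK) hA.prop.1
  exact ⟨k, hk, hDJ.trans (hA.le_of_ge ⟨hJK, (isTorus_iff c).mpr hJ⟩ hAJ)⟩

theorem dim_le {n m : ℕ} (hD : IsTorusOfDim D n) (hDK : D ≤ K) (hA : IsMaximalTorus K A)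
    (hAm : IsTorusOfDim A m) : n ≤ m := by
  obtain ⟨k, -, hle⟩ := h.exists_conj_le (isToral_of_isTorusOfDim hD) hDK hA
  rw [← c.finrank_lie_eq (isTorusOfDim_conjSubgroup k hD), ← c.finrank_lie_eq hAm]
  exact Submodule.finrank_mono (lie_mono hle)

theorem isTorusOfDim_of_hasRank {r : ℕ} (hA : IsMaximalTorus K A) (hr : HasRank K r) :
    IsTorusOfDim A r := by
  obtain ⟨A', hA', hr'⟩ := hr
  obtain ⟨m, hm⟩ := hA.prop.2
  rwa [← le_antisymm (h.dim_le hm hA.prop.1 hA' hr') (h.dim_le hr' hA'.prop.1 hA hm)]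

/-- The closure of the one-parameter subgroup of `Y` is a torus of `K` commuting with `A`; its
product with `A` is again a torus of `K`, and maximality absorbs it. -/
theorem mem_lie_of_commute (hA : IsMaximalTorus K A) {Y : E} (hY : L Y = Y)
    (hcomm : ∀ a ∈ A, c.Ad a Y = Y) : Y ∈ c.lie A := by
  have hAt : IsToral A := (isTorus_iff c).mp hA.prop.2
  obtain ⟨J, hJ, hYJ, hJmin⟩ := c.exists_toral_of_exp Y
  have hJK : J ≤ K := hJmin K h.isClosed ((h.apply_eq_iff Y).mp hY)
  have hJA : J ≤ Subgroup.centralizer (A : Set G) := hJmin _ (isClosed_centralizer _) fun t => by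
    rw [Subgroup.mem_centralizer_iff]
    exact fun a ha => (c.Ad_eq_self_iff a Y).mp (hcomm a ha) t
  obtain ⟨M, hM, hJM, hAM, hMle⟩ := hJ.exists_mul hAt fun x hx a ha =>
    (Subgroup.mem_centralizer_iff.mp (hJA hx) a ha).symm
  have hMA : M ≤ A :=
    hA.le_of_ge ⟨hMle K hJK hA.prop.1, (isTorus_iff c).mpr hM⟩ hAM
  exact lie_mono (hJM.trans hMA) hYJ

/-- The centralizer of `A` in the Lie algebra is abelian. For `X` in it, `X + L X` is fixed by `L`,
hence lies in `lie A`, so `L X` equals `-X` modulo vectors that commute with the whole centralizer.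
Therefore `W = [X, Y]` is fixed by `L` and also lies in `lie A`. Then `[X, W] = 0`, and invariance
of the form gives `B W W = 0`. -/
theorem bracket_eq_zero_of_commute (hA : IsMaximalTorus K A) {X Y : E}
    (hX : ∀ a ∈ A, c.Ad a X = X) (hY : ∀ a ∈ A, c.Ad a Y = Y) : c.bracket X Y = 0 := by
  have hAt : IsToral A := (isTorus_iff c).mp hA.prop.2
  obtain ⟨B, hsymm, hdef, hinv⟩ := c.exists_invariant_form
  have hsum : ∀ {X : E}, (∀ a ∈ A, c.Ad a X = X) → X + L X ∈ c.lie A := by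
    intro X hX
    refine h.mem_lie_of_commute hA ?_ fun a ha => ?_
    · rw [map_add, h.apply_apply, add_comm]
    · rw [map_add, ← h.apply_Ad (hA.prop.1 ha), hX a ha]
  have hlie : ∀ {V X : E}, V ∈ c.lie A → (∀ a ∈ A, c.Ad a X = X) → c.bracket V X = 0 := by
    intro V X hV hX
    rw [c.bracket_eq_zero_iff]
    exact fun s t => (c.Ad_eq_self_iff _ _).mp (hX _ ((mem_lie hAt.isAbelian).mp hV s)) t
  have hfix : ∀ {V : E}, V ∈ c.lie A → ∀ a ∈ A, c.Ad a V = V := by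
    intro V hV a ha
    rw [c.Ad_eq_self_iff]
    exact fun t => hAt.isAbelian a ha _ ((mem_lie hAt.isAbelian).mp hV t)
  set W := c.bracket X Y with hW
  have hLX : L X = (X + L X) - X := by abel
  have hLY : L Y = (Y + L Y) - Y := by abel
  have hLW : L W = W := by
    rw [hW, h.map_bracket, hLX, hLY]
    simp only [map_sub, sub_apply]
    rw [hlie (hsum hX) (hfix (hsum hY)), hlie (hsum hX) hY, c.bracket_antisymm (Y + L Y) X,
      hlie (hsum hY) hX]
    simp
  have hWA : W ∈ c.lie A := h.mem_lie_of_commute hA hLW fun a ha => by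
    rw [hW, c.Ad_bracket, hX a ha, hY a ha]
  have h1 := c.invariant_form_bracket hinv X Y W
  rw [c.bracket_antisymm W X, hlie hWA hX, neg_zero, map_zero, add_zero] at h1
  exact hdef _ h1

/-- A maximal torus of `K` is contained in a unique maximal torus of `G`. -/
theorem maximalTorus_unique {T T' : Subgroup G} (hA : IsMaximalTorus K A)
    (hT : IsMaximalTorus ⊤ T) (hT' : IsMaximalTorus ⊤ T') (hAT : A ≤ T) (hAT' : A ≤ T') :
    T = T' := by
  have hTt : IsToral T := (isTorus_iff c).mp hT.prop.2
  have hTt' : IsToral T' := (isTorus_iff c).mp hT'.prop.2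
  obtain ⟨X, hXT, hX⟩ := IsToral.exists_generator c hTt
  obtain ⟨Y, hYT, hY⟩ := IsToral.exists_generator c hTt'
  -- Generators of `T` and `T'` both centralize `A`, so the two tori commute; their product is a
  -- torus, equal to each of them by maximality.
  have hcomm := commute_of_bracket_eq_zero hX hY (h.bracket_eq_zero_of_commute hA
    (fun a ha => (c.Ad_eq_self_iff a X).mpr fun t =>
      hTt.isAbelian a (hAT ha) _ ((mem_lie hTt.isAbelian).mp hXT t))
    (fun a ha => (c.Ad_eq_self_iff a Y).mpr fun t =>
      hTt'.isAbelian a (hAT' ha) _ ((mem_lie hTt'.isAbelian).mp hYT t)))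
  obtain ⟨J, hJ, hTJ, hTJ', -⟩ := hTt.exists_mul hTt' hcomm
  have hJt : J ≤ ⊤ ∧ IsTorus J := ⟨le_top, (isTorus_iff c).mpr hJ⟩
  exact le_antisymm (hTJ.trans (hT'.le_of_ge hJt hTJ')) (hTJ'.trans (hT.le_of_ge hJt hTJ))

end IsFixedPair
end LocalCoord

/-! ### Coordinates from a chart of a Lie group -/

section LieGroup

variable (E : Type*) [NormedAddCommGroup E] [NormedSpace ℝ E]
  (G : Type*) [Group G] [TopologicalSpace G] [ChartedSpace E G] [LieGroup 𝓘(ℝ, E) ∞ G]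

theorem contMDiffAt_chart_sub :
    ContMDiffAt 𝓘(ℝ, E) 𝓘(ℝ, E) ∞ (fun g : G => chartAt E (1 : G) g - chartAt E (1 : G) 1) 1 := by
  have h : ContMDiffAt 𝓘(ℝ, E) 𝓘(ℝ, E) ∞ (chartAt E (1 : G)) 1 :=
    contMDiffOn_chart.contMDiffAt ((chartAt E (1 : G)).open_source.mem_nhds (mem_chart_source E 1))
  exact ContMDiffAt.sub (I' := 𝓘(ℝ, E)) h contMDiffAt_const

theorem contMDiffAt_chart_symm_add : ContMDiffAt 𝓘(ℝ, E) 𝓘(ℝ, E) ∞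
    (fun u : E => (chartAt E (1 : G)).symm (u + chartAt E (1 : G) 1)) 0 := by
  have h : ContMDiffAt 𝓘(ℝ, E) 𝓘(ℝ, E) ∞ (chartAt E (1 : G)).symm (0 + chartAt E (1 : G) 1) := by
    refine contMDiffOn_chart_symm.contMDiffAt ((chartAt E (1 : G)).open_target.mem_nhds ?_)
    rw [zero_add]
    exact mem_chart_target E 1
  refine ContMDiffAt.comp (0 : E) h ?_
  exact (contDiff_id.add contDiff_const).contMDiff.contMDiffAt

variable {E G} in
theorem contDiffAt_chart_sub_comp {F : Type*} [NormedAddCommGroup F] [NormedSpace ℝ F] {f : F → G}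
    (hf : ContMDiffAt 𝓘(ℝ, F) 𝓘(ℝ, E) ∞ f 0) (h1 : f 0 = 1) :
    ContDiffAt ℝ ∞ (fun z => chartAt E (1 : G) (f z) - chartAt E (1 : G) 1) 0 := by
  rw [← contMDiffAt_iff_contDiffAt]
  refine ContMDiffAt.comp (0 : F) (g := fun g : G => chartAt E (1 : G) g - chartAt E (1 : G) 1) ?_ hf
  rw [h1]
  exact contMDiffAt_chart_sub E G

variable {F : Type*} [NormedAddCommGroup F] [NormedSpace ℝ F] in
theorem contMDiffAt_chart_symm_comp (L : F →L[ℝ] E) : ContMDiffAt 𝓘(ℝ, F) 𝓘(ℝ, E) ∞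
    (fun z : F => (chartAt E (1 : G)).symm (L z + chartAt E (1 : G) 1)) 0 := by
  refine ContMDiffAt.comp (0 : F)
    (g := fun u : E => (chartAt E (1 : G)).symm (u + chartAt E (1 : G) 1)) ?_
    L.contDiff.contMDiff.contMDiffAt
  rw [map_zero]
  exact contMDiffAt_chart_symm_add E G

/-- The coordinates of a Lie group given by a chart at the identity. -/
def chartCoord : LocalCoord E G where
  coord g := chartAt E (1 : G) g - chartAt E (1 : G) 1
  point u := (chartAt E (1 : G)).symm (u + chartAt E (1 : G) 1)
  coord_one := sub_self _
  continuousAt_coord := by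
    filter_upwards [(chartAt E (1 : G)).open_source.mem_nhds (mem_chart_source E 1)] with g hg
    exact ((chartAt E (1 : G)).continuousAt hg).sub continuousAt_const
  continuousAt_point := by
    have ht : Tendsto (fun u : E => u + chartAt E (1 : G) 1) (𝓝 0) (𝓝 (chartAt E (1 : G) 1)) :=
      (continuous_add_const _).tendsto' _ _ (zero_add _)
    filter_upwards [ht ((chartAt E (1 : G)).open_target.mem_nhds (mem_chart_target E 1))] with u hu
    exact ContinuousAt.comp (g := (chartAt E (1 : G)).symm)
      ((chartAt E (1 : G)).continuousAt_symm hu) (continuous_add_const _).continuousAt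
  point_coord := by
    filter_upwards [(chartAt E (1 : G)).open_source.mem_nhds (mem_chart_source E 1)] with g hg
    rw [sub_add_cancel, (chartAt E (1 : G)).left_inv hg]
  coord_point := by
    have ht : Tendsto (fun u : E => u + chartAt E (1 : G) 1) (𝓝 0) (𝓝 (chartAt E (1 : G) 1)) :=
      (continuous_add_const _).tendsto' _ _ (zero_add _)
    filter_upwards [ht ((chartAt E (1 : G)).open_target.mem_nhds (mem_chart_target E 1))] with u hu
    rw [(chartAt E (1 : G)).right_inv hu, add_sub_cancel_right]
  contDiffAt_mul := by
    have h1 := contMDiffAt_chart_symm_comp E G (ContinuousLinearMap.fst ℝ E E)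
    have h2 := contMDiffAt_chart_symm_comp E G (ContinuousLinearMap.snd ℝ E E)
    refine (contDiffAt_chart_sub_comp (h1.mul h2) ?_).of_le ENat.LEInfty.out
    simp
  contDiffAt_comm := by
    have h1 := contMDiffAt_chart_symm_comp E G (ContinuousLinearMap.fst ℝ E E)
    have h2 := contMDiffAt_chart_symm_comp E G (ContinuousLinearMap.snd ℝ E E)
    refine (contDiffAt_chart_sub_comp (((h1.mul h2).mul h1.inv).mul h2.inv) ?_).of_le
      ENat.LEInfty.out
    simp
  differentiableAt_conj g := by
    have h1 := contMDiffAt_chart_symm_comp E G (ContinuousLinearMap.id ℝ E)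
    refine (contDiffAt_chart_sub_comp ((contMDiffAt_const (c := g)).mul h1 |>.mul
      (contMDiffAt_const (c := g⁻¹))) ?_).differentiableAt (by simp)
    simp

variable {E G} in
/-- A symmetric pair gives fixed points of an involution in coordinates. -/
theorem IsSymmetricPair.exists_isFixedPair {σ : G →* G} {K : Subgroup G}
    (h : IsSymmetricPair E σ K) : ∃ L : E →L[ℝ] E, (chartCoord E G).IsFixedPair σ L K := by
  refine ⟨fderiv ℝ (fun u => (chartCoord E G).coord (σ ((chartCoord E G).point u))) 0,
    h.smooth.continuous.continuousAt, ?_, h.involutive, h.isClosed, h.component_subset, h.fixed⟩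
  refine (DifferentiableAt.hasFDerivAt ?_)
  have h1 := contMDiffAt_chart_symm_add E G
  refine (contDiffAt_chart_sub_comp (h.smooth.contMDiffAt.comp (0 : E) h1) ?_).differentiableAt
    (by simp)
  simp

end LieGroup

/-! ### Dimension of torus orbits -/

section Dimension

/-- One-dimensional Borsuk–Ulam: on a small circle, the difference of the values at antipodal points
changes sign over half a turn, hence vanishes somewhere. -/
theorem not_injOn_plane {f : ℝ × ℝ → ℝ} {U : Set (ℝ × ℝ)} (hU : U ∈ 𝓝 (0 : ℝ × ℝ))
    (hf : ContinuousOn f U) : ¬ Set.InjOn f U := by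
  intro hinj
  obtain ⟨r, hr, hball⟩ := Metric.mem_nhds_iff.mp hU
  let p : ℝ → ℝ × ℝ := fun θ => (r / 2 * Real.cos θ, r / 2 * Real.sin θ)
  have hp : Continuous p := by fun_prop
  have hpU : ∀ θ, p θ ∈ U := fun θ => hball (by
    have h1 := Real.abs_cos_le_one θ
    have h2 := Real.abs_sin_le_one θ
    simp only [p, Metric.mem_ball, dist_zero_right, Prod.norm_def, Real.norm_eq_abs, abs_mul,
      abs_of_pos (half_pos hr), max_lt_iff]
    constructor <;> nlinarith)
  have hg : Continuous fun θ => f (p θ) := hf.comp_continuous hp hpU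
  let k : ℝ → ℝ := fun θ => f (p θ) - f (p (θ + Real.pi))
  have hk : Continuous k := hg.sub (hg.comp (continuous_add_const Real.pi))
  have hper : p (Real.pi + Real.pi) = p 0 := by
    simp only [p, ← two_mul, Real.cos_two_pi, Real.sin_two_pi, Real.cos_zero, Real.sin_zero]
  have hkpi : k Real.pi = -k 0 := by
    simp only [k, hper, zero_add]
    ring
  obtain ⟨θ, -, hθ⟩ : (0 : ℝ) ∈ k '' Set.uIcc 0 Real.pi := by
    refine intermediate_value_uIcc hk.continuousOn ?_
    rw [hkpi, Set.mem_uIcc]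
    rcases le_total 0 (k 0) with h | h
    · right; constructor <;> linarith
    · left; constructor <;> linarith
  have he := hinj (hpU θ) (hpU (θ + Real.pi)) (sub_eq_zero.mp hθ)
  simp only [p, Real.cos_add_pi, Real.sin_add_pi, Prod.mk.injEq] at he
  have hc : Real.cos θ = 0 := by
    have : r * Real.cos θ = 0 := by linarith [he.1]
    exact (mul_eq_zero.mp this).resolve_left hr.ne'
  have hs : Real.sin θ = 0 := by
    have : r * Real.sin θ = 0 := by linarith [he.2]
    exact (mul_eq_zero.mp this).resolve_left hr.ne'
  have := Real.sin_sq_add_cos_sq θ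
  rw [hc, hs] at this
  norm_num at this

theorem isLocallyEuclideanOfDim_of_homeomorph {X Y : Type*} [TopologicalSpace X]
    [TopologicalSpace Y] (e : X ≃ₜ Y) {n : ℕ} (h : IsLocallyEuclideanOfDim Y n) :
    IsLocallyEuclideanOfDim X n := by
  obtain ⟨_⟩ := h
  have := e.toOpenPartialHomeomorph.singletonChartedSpace rfl
  exact ⟨ChartedSpace.comp (EuclideanSpace ℝ (Fin n)) Y X⟩

theorem isLocallyEuclideanOfDim_one_torus : IsLocallyEuclideanOfDim (Fin 1 → Circle) 1 :=
  isLocallyEuclideanOfDim_of_homeomorph (Homeomorph.funUnique (Fin 1) Circle)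
    ⟨inferInstance⟩

/-- For `m = 0` a chart would make a point open in the line; for `m ≥ 2` two of the circle
coordinates would embed a planar neighbourhood into the line. -/
theorem eq_one_of_isLocallyEuclideanOfDim {m : ℕ}
    (h : IsLocallyEuclideanOfDim (Fin m → Circle) 1) : m = 1 := by
  obtain ⟨_⟩ := h
  let e := chartAt (EuclideanSpace ℝ (Fin 1)) (1 : Fin m → Circle)
  have h1 : (1 : Fin m → Circle) ∈ e.source := mem_chart_source _ _
  rcases Nat.lt_or_ge m 2 with hm | hm
  · interval_cases m
    · exfalso
      have hsing : e.target = {e 1} := by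
        refine Set.eq_singleton_iff_unique_mem.mpr ⟨e.map_source h1, fun y hy => ?_⟩
        rw [← e.right_inv hy]
        congr 1
        exact Subsingleton.elim _ _
      have := e.open_target
      rw [hsing] at this
      exact not_isOpen_singleton _ this
    · rfl
  · exfalso
    let i : Fin m := ⟨0, by omega⟩
    let j : Fin m := ⟨1, by omega⟩
    have hij : j ≠ i := by simp [i, j]
    let ψ : ℝ × ℝ → (Fin m → Circle) := fun z l =>
      if l = i then Circle.exp z.1 else if l = j then Circle.exp z.2 else 1
    have hψ : Continuous ψ := by
      refine continuous_pi fun l => ?_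
      simp only [ψ]
      split_ifs
      · exact Circle.exp.continuous.comp continuous_fst
      · exact Circle.exp.continuous.comp continuous_snd
      · exact continuous_const
    have hψ0 : ψ 0 = 1 := by
      funext l
      simp [ψ]
    let U : Set (ℝ × ℝ) := ψ ⁻¹' e.source ∩ Metric.ball 0 1
    have hU : U ∈ 𝓝 (0 : ℝ × ℝ) := by
      refine inter_mem (hψ.continuousAt.preimage_mem_nhds ?_) (Metric.ball_mem_nhds 0 one_pos)
      rw [hψ0]
      exact e.open_source.mem_nhds h1
    refine not_injOn_plane (f := fun z => e (ψ z) 0) hU ?_ ?_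
    · have : ContinuousOn (fun z => e (ψ z)) U :=
        e.continuousOn.comp hψ.continuousOn fun z hz => hz.1
      exact (EuclideanSpace.proj (𝕜 := ℝ) (0 : Fin 1)).continuous.comp_continuousOn this
    · intro z hz w hw hzw
      have h2 : e (ψ z) = e (ψ w) := by
        ext l
        rw [Subsingleton.elim l 0]
        exact hzw
      have h3 := e.injOn hz.1 hw.1 h2
      have hz1 := hz.2
      have hw1 := hw.2
      simp only [Metric.mem_ball, dist_zero_right, Prod.norm_def, Real.norm_eq_abs, max_lt_iff,
        abs_lt] at hz1 hw1
      have hinj := Circle.exp_injOn_Icc (a := -1) (b := 1) (by linarith [Real.pi_gt_three])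
      have ha := congrFun h3 i
      have hb := congrFun h3 j
      simp only [ψ, if_true, if_neg hij] at ha hb
      refine Prod.ext (hinj ⟨hz1.1.1.le, hz1.1.2.le⟩ ⟨hw1.1.1.le, hw1.1.2.le⟩ ha)
        (hinj ⟨hz1.2.1.le, hz1.2.2.le⟩ ⟨hw1.2.1.le, hw1.2.2.le⟩ hb)

end Dimension

namespace LocalCoord

variable {E G : Type*} [NormedAddCommGroup E] [NormedSpace ℝ E] [FiniteDimensional ℝ E] [Group G]
    [TopologicalSpace G] [IsTopologicalGroup G] [T2Space G] [CompactSpace G] (c : LocalCoord E G)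

/-- The quotient of a torus by a closed subgroup is a torus. -/
theorem exists_quotient_homeomorph {T : Subgroup G} (hT : IsToral T) (N : Subgroup T)
    (hN : IsClosed (N : Set T)) : ∃ m : ℕ, Nonempty ((T ⧸ N) ≃ₜ (Fin m → Circle)) ∧
      m + Module.finrank ℝ (c.lie (N.map T.subtype)) = Module.finrank ℝ (c.lie T) := by
  set C := N.map T.subtype with hC
  have hCT : C ≤ T := by
    rintro _ ⟨t, -, rfl⟩
    exact t.2
  have hCab : IsAbelian C := fun a ha b hb => hT.isAbelian a (hCT ha) b (hCT hb)
  have hCcl : IsClosed (C : Set G) := hT.isClosed.isClosedEmbedding_subtypeVal.isClosedMap _ hN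
  have hmemN : ∀ t : T, t ∈ N ↔ (t : G) ∈ C := fun t =>
    ⟨fun h => ⟨t, h, rfl⟩, fun ⟨s, hs, h⟩ => (Subtype.ext h : s = t) ▸ hs⟩
  have hnorm : N.Normal := ⟨fun n hn t => by
    have : t * n * t⁻¹ = n := by
      refine Subtype.ext ?_
      simp only [Subgroup.coe_mul, Subgroup.coe_inv]
      rw [hT.isAbelian t t.2 n n.2, mul_inv_cancel_right]
    rwa [this]⟩
  have hlie : c.lie C ≤ c.lie T := lie_mono hCT
  -- A complement `W` of `lie C` in `lie T` serves as the universal cover of the quotient: the `lie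
  -- C` component of a vector is killed by passing to `T ⧸ N`.
  obtain ⟨Q, hQ⟩ := (c.lie C).exists_isCompl
  set W := Q ⊓ c.lie T with hW
  have hsup : c.lie C ⊔ W = c.lie T := by
    rw [hW, ← sup_inf_assoc_of_le Q hlie, hQ.sup_eq_top, top_inf_eq]
  have hinf : c.lie C ⊓ W = ⊥ := by
    rw [eq_bot_iff, ← hQ.inf_eq_bot]
    exact inf_le_inf_left _ inf_le_left
  have hWT : W ≤ c.lie T := inf_le_right
  have : CompactSpace T := isCompact_iff_compactSpace.mp hT.isClosed.isCompact
  have hcl : IsClosed (N : Set T) := hN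
  have : T3Space (T ⧸ N) := QuotientGroup.instT3Space N
  let e : Multiplicative W →* T ⧸ N := (QuotientGroup.mk' N).comp ((expOnto (c := c) hT.isAbelian).comp
    (AddMonoidHom.toMultiplicative (Submodule.inclusion hWT).toAddMonoidHom))
  have he : ∀ w : W, e (Multiplicative.ofAdd w) =
      QuotientGroup.mk (⟨c.exp w, exp_mem hT.isAbelian (hWT w.2)⟩ : T) := fun w => rfl
  have hec : Continuous e := by
    refine continuous_quot_mk.comp (Continuous.subtype_mk (f := fun w : W => c.exp w) ?_ _)
    exact (continuousOn_exp hT.isAbelian).comp_continuous continuous_subtype_val fun w => hWT w.2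
  have hes : Function.Surjective e := by
    intro q
    obtain ⟨⟨t, ht⟩, rfl⟩ := QuotientGroup.mk_surjective q
    obtain ⟨X, hX, rfl⟩ := IsToral.exists_exp (c := c) hT ht
    have hX' := hX
    rw [← hsup] at hX'
    obtain ⟨Y, hY, Z, hZ, rfl⟩ := Submodule.mem_sup.mp hX'
    refine ⟨Multiplicative.ofAdd ⟨Z, hZ⟩, ?_⟩
    rw [he, QuotientGroup.eq, hmemN]
    simp only [Subgroup.coe_mul, Subgroup.coe_inv]
    rw [add_comm, exp_add hT.isAbelian (hWT hZ) (hlie hY), inv_mul_cancel_left]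
    exact exp_mem hCab hY
  -- If `exp w` lies in `C` for small `w`, it is also `exp Y` with `Y ∈ lie C` small; local
  -- injectivity gives `w = Y`, which lies in `lie C ⊓ W = ⊥`.
  have hinj : ∃ r > 0, ∀ w : W, ‖w‖ < r → e (Multiplicative.ofAdd w) = 1 → w = 0 := by
    obtain ⟨r, hr, hr'⟩ := c.exists_exp_inj
    have hev := c.tendsto_exp.eventually
      (eventually_mem_exp_lie (c := c) hCab hCcl (half_pos hr))
    obtain ⟨δ, hδ, H⟩ := Metric.eventually_nhds_iff.mp hev
    refine ⟨min δ (r / 2), by positivity, fun w hw h1 => ?_⟩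
    have hwC : c.exp w ∈ C := by
      rw [he, QuotientGroup.eq_one_iff, hmemN] at h1
      exact h1
    have hw' : ‖(w : E)‖ < min δ (r / 2) := hw
    obtain ⟨Y, hY, hYr, hYw⟩ := H (by
      simpa using lt_of_lt_of_le hw' (min_le_left _ _)) hwC
    have hz : (w : E) - Y = 0 := by
      refine hr' _ ?_ ?_
      · have := lt_of_lt_of_le hw' (min_le_right _ _)
        linarith [norm_sub_le (w : E) Y]
      · rw [sub_eq_add_neg, exp_add hT.isAbelian (hWT w.2) (Submodule.neg_mem _ (hlie hY)),
          c.exp_neg, hYw, mul_inv_cancel]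
    have hb : (w : E) ∈ c.lie C ⊓ W := ⟨by rw [sub_eq_zero.mp hz]; exact hY, w.2⟩
    rw [hinf] at hb
    exact Subtype.ext hb
  obtain ⟨f⟩ := exists_equiv_torus e hec hes hinj
  refine ⟨_, ⟨f.toHomeomorph⟩, ?_⟩
  have := Submodule.finrank_sup_add_finrank_inf_eq (c.lie C) W
  rw [hsup, hinf, finrank_bot] at this
  omega

/-- An orbit of a torus is one-dimensional iff the stabilizer has codimension one. -/
theorem isLocallyEuclideanOfDim_orbit_iff {T K : Subgroup G} (hT : IsToral T)
    (hK : IsClosed (K : Set G)) (a : G) :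
    IsLocallyEuclideanOfDim (MulAction.orbit T (QuotientGroup.mk a : G ⧸ K)) 1 ↔
      1 + Module.finrank ℝ (c.lie (T ⊓ conjSubgroup a K)) = Module.finrank ℝ (c.lie T) := by
  have : T2Space (G ⧸ K) := by
    rw [t2Space_iff_of_isOpenQuotientMap QuotientGroup.isOpenQuotientMap_mk]
    have : {q : G × G | (QuotientGroup.mk q.1 : G ⧸ K) = QuotientGroup.mk q.2} =
        (fun q : G × G => q.1⁻¹ * q.2) ⁻¹' K := by
      ext q
      exact QuotientGroup.eq
    rw [this]
    exact hK.preimage (by fun_prop)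
  have : CompactSpace T := isCompact_iff_compactSpace.mp hT.isClosed.isCompact
  set x : G ⧸ K := QuotientGroup.mk a
  set N := MulAction.stabilizer T x
  have hact : Continuous fun t : T => t • x :=
    QuotientGroup.continuous_mk.comp ((continuous_subtype_val).mul continuous_const)
  have hN : IsClosed (N : Set T) := isClosed_eq hact continuous_const
  have hNC : N.map T.subtype = T ⊓ conjSubgroup a K := by
    ext g
    constructor
    · rintro ⟨t, ht, rfl⟩
      refine ⟨t.2, ?_⟩
      have h1 : (QuotientGroup.mk ((t : G) * a) : G ⧸ K) = QuotientGroup.mk a := ht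
      rw [eq_comm, QuotientGroup.eq] at h1
      refine mem_conjSubgroup.mpr ?_
      simpa [mul_assoc] using h1
    · rintro ⟨h1, h2⟩
      refine ⟨⟨g, h1⟩, ?_, rfl⟩
      change (QuotientGroup.mk (g * a) : G ⧸ K) = QuotientGroup.mk a
      rw [eq_comm, QuotientGroup.eq]
      have h3 := mem_conjSubgroup.mp h2
      simpa [mul_assoc] using h3
  obtain ⟨m, ⟨f⟩, hm⟩ := c.exists_quotient_homeomorph hT N hN
  rw [hNC] at hm
  let φ : T ⧸ N ≃ MulAction.orbit T x := (MulAction.orbitEquivQuotientStabilizer T x).symm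
  have hφ : Continuous φ := by
    rw [(QuotientGroup.isQuotientMap_mk (N := N)).continuous_iff]
    exact hact.subtype_mk fun t => ⟨t, rfl⟩
  -- The orbit bijection is a homeomorphism, since `T ⧸ N` is compact and `G ⧸ K` is Hausdorff.
  let F : MulAction.orbit T x ≃ₜ (Fin m → Circle) := (hφ.homeoOfEquivCompactToT2).symm.trans f
  have hm1 : IsLocallyEuclideanOfDim (MulAction.orbit T x) 1 ↔ m = 1 :=
    ⟨fun h => eq_one_of_isLocallyEuclideanOfDim
      (isLocallyEuclideanOfDim_of_homeomorph F.symm h),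
    fun h => isLocallyEuclideanOfDim_of_homeomorph F (h ▸ isLocallyEuclideanOfDim_one_torus)⟩
  rw [hm1]
  omega

end LocalCoord

/-! ### Cosets in the Weyl group and `T`-orbits -/

section Weyl

variable {G : Type*} [Group G]

theorem weylClass_eq_iff {K T : Subgroup G} {g h : Subgroup.normalizer (T : Set G)} :
    weylClass K T g = weylClass K T h ↔
      ∃ z : normalizerIn K T, (z : G)⁻¹ * (h * (g : G)⁻¹) ∈ T := by
  rw [weylClass, weylClass, Quotient.eq, QuotientGroup.rightRel_apply]
  constructor
  · rintro ⟨w, hw⟩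
    obtain ⟨z, rfl⟩ := QuotientGroup.mk_surjective w
    have hw : (QuotientGroup.mk (Subgroup.inclusion inf_le_left z) : WeylGroup T) =
      QuotientGroup.mk (h * g⁻¹) := hw
    exact ⟨z, Subgroup.mem_subgroupOf.mp (QuotientGroup.eq.mp hw)⟩
  · rintro ⟨z, hz⟩
    exact ⟨QuotientGroup.mk z, QuotientGroup.eq.mpr hz⟩

/-- If `t h⁻¹ K = g⁻¹ K`, then `z = h t⁻¹ g⁻¹` lies in `K` and in `N_G(T)`, and `z⁻¹ (h g⁻¹) = g t
g⁻¹` lies in `T`, so `z` represents the class of `h g⁻¹`. The converse reverses this computation. -/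
theorem weylClass_eq_iff_orbit_eq {K T : Subgroup G} {g h : Subgroup.normalizer (T : Set G)} :
    weylClass K T g = weylClass K T h ↔
      MulAction.orbit T (QuotientGroup.mk (g : G)⁻¹ : G ⧸ K) =
        MulAction.orbit T (QuotientGroup.mk (h : G)⁻¹ : G ⧸ K) := by
  rw [weylClass_eq_iff, MulAction.orbit_eq_iff]
  constructor
  · rintro ⟨⟨z, hzN, hzK⟩, hz⟩
    have ht : (g : G)⁻¹ * (z⁻¹ * (h * (g : G)⁻¹)) * g ∈ T :=
      (Subgroup.mem_normalizer_iff''.mp g.2 _).mp hz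
    refine ⟨⟨_, ht⟩, ?_⟩
    change (QuotientGroup.mk (_ * (h : G)⁻¹) : G ⧸ K) = QuotientGroup.mk _
    rw [QuotientGroup.eq]
    have hk : ((g : G)⁻¹ * (z⁻¹ * (h * (g : G)⁻¹)) * g * (h : G)⁻¹)⁻¹ * (g : G)⁻¹ = z := by group
    exact (congrArg (· ∈ K) hk).mpr hzK
  · rintro ⟨⟨t, ht⟩, he⟩
    have he : (QuotientGroup.mk (t * (h : G)⁻¹) : G ⧸ K) = QuotientGroup.mk (g : G)⁻¹ := he
    rw [QuotientGroup.eq] at he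
    have hzN : (t * (h : G)⁻¹)⁻¹ * (g : G)⁻¹ ∈ Subgroup.normalizer (T : Set G) :=
      mul_mem (inv_mem (mul_mem (Subgroup.le_normalizer ht) (inv_mem h.2))) (inv_mem g.2)
    refine ⟨⟨_, hzN, he⟩, ?_⟩
    convert (Subgroup.mem_normalizer_iff.mp g.2 _).mp ht using 1
    simp only
    group

end Weyl

theorem isMaximalTorus_conjSubgroup {G : Type*} [Group G] [TopologicalSpace G]
    [IsTopologicalGroup G] {T : Subgroup G} (hT : IsMaximalTorus ⊤ T) (g : G) :
    IsMaximalTorus ⊤ (conjSubgroup g T) := by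
  obtain ⟨n, hn⟩ := hT.prop.2
  refine ⟨⟨le_top, n, isTorusOfDim_conjSubgroup g hn⟩, ?_⟩
  rintro B ⟨-, m, hm⟩ hle
  have h1 : T ≤ conjSubgroup g⁻¹ B := by
    have := conjSubgroup_mono g⁻¹ hle
    rwa [← conjSubgroup_mul, inv_mul_cancel, conjSubgroup_one] at this
  have h2 := conjSubgroup_mono g
    (hT.le_of_ge ⟨le_top, m, isTorusOfDim_conjSubgroup g⁻¹ hm⟩ h1)
  rwa [← conjSubgroup_mul, mul_inv_cancel, conjSubgroup_one] at h2

theorem mem_normalizer_of_conjSubgroup_eq {G : Type*} [Group G] {T : Subgroup G} {g : G}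
    (h : conjSubgroup g T = T) : g ∈ Subgroup.normalizer (T : Set G) := by
  rw [Subgroup.mem_normalizer_iff]
  intro x
  conv_rhs => rw [← h, mem_conjSubgroup]
  simp [mul_assoc]

theorem conjSubgroup_eq_of_mem_normalizer {G : Type*} [Group G] {T : Subgroup G} {g : G}
    (h : g ∈ Subgroup.normalizer (T : Set G)) : conjSubgroup g T = T := by
  ext x
  rw [mem_conjSubgroup, Subgroup.mem_normalizer_iff.mp h]
  simp [mul_assoc]

/-! ### Points whose stabilizer in `T` has the rank of `K` -/

namespace LocalCoord.IsFixedPair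

variable {E G : Type*} [NormedAddCommGroup E] [NormedSpace ℝ E] [FiniteDimensional ℝ E] [Group G]
    [TopologicalSpace G] [IsTopologicalGroup G] [T2Space G] [CompactSpace G] {c : LocalCoord E G}
    {σ : G →* G} {L : E →L[ℝ] E} {K S T : Subgroup G} {r : ℕ}

/-- The stabilizer may be disconnected; its identity component is a torus with the same Lie algebra,
to which the conjugacy results apply. -/
theorem exists_toral_inf_conjSubgroup (h : c.IsFixedPair σ L K) (hT : IsToral T) (a : G) :
    ∃ D : Subgroup G, D ≤ T ⊓ conjSubgroup a K ∧ IsToral D ∧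
      c.lie D = c.lie (T ⊓ conjSubgroup a K) := by
  have hab : IsAbelian (T ⊓ conjSubgroup a K) :=
    fun x hx y hy => hT.isAbelian x hx.1 y hy.1
  have hcl : IsClosed ((T ⊓ conjSubgroup a K : Subgroup G) : Set G) := by
    refine hT.isClosed.inter ?_
    change IsClosed (conjSubgroup a K : Set G)
    have : (conjSubgroup a K : Set G) = (fun x => a⁻¹ * x * a) ⁻¹' K :=
      Set.ext fun x => mem_conjSubgroup
    rw [this]
    exact h.isClosed.preimage (by fun_prop)
  exact ⟨_, range_expHom_le (c := c) hab, isToral_range_expHom hab hcl, lie_range_expHom hab⟩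

/-- For `g` normalizing `T`, the stabilizer in `T` of the point `g⁻¹ K` has the rank of `K`. -/
theorem finrank_lie_stabilizer (h : c.IsFixedPair σ L K) (hS : IsMaximalTorus K S)
    (hSr : IsTorusOfDim S r) (hT : IsToral T) (hST : S ≤ T) {a : G}
    (ha : a ∈ Subgroup.normalizer (T : Set G)) :
    Module.finrank ℝ (c.lie (T ⊓ conjSubgroup a K)) = r := by
  refine le_antisymm ?_ ?_
  · obtain ⟨D, hDle, hD, hDl⟩ := h.exists_toral_inf_conjSubgroup hT a
    rw [← hDl]
    refine h.dim_le (isTorusOfDim_conjSubgroup a⁻¹ (IsToral.isTorusOfDim (c := c) hD)) ?_ hS hSr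
    have := conjSubgroup_mono a⁻¹ (hDle.trans inf_le_right)
    rwa [← conjSubgroup_mul, inv_mul_cancel, conjSubgroup_one] at this
  · rw [← c.finrank_lie_eq (isTorusOfDim_conjSubgroup a hSr)]
    refine Submodule.finrank_mono (lie_mono (le_inf ?_ (conjSubgroup_mono a hS.prop.1)))
    exact (conjSubgroup_mono a hST).trans_eq (conjSubgroup_eq_of_mem_normalizer ha)

/-- A point whose stabilizer in `T` has the rank of `K` is represented by an element normalizing
`T`. -/
theorem exists_mem_normalizer (h : c.IsFixedPair σ L K) (hS : IsMaximalTorus K S)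
    (hSr : IsTorusOfDim S r) (hT : IsMaximalTorus ⊤ T) (hST : S ≤ T) {a : G}
    (hr : Module.finrank ℝ (c.lie (T ⊓ conjSubgroup a K)) = r) :
    ∃ g ∈ Subgroup.normalizer (T : Set G),
      (QuotientGroup.mk g⁻¹ : G ⧸ K) = QuotientGroup.mk a := by
  obtain ⟨D, hDle, hD, hDl⟩ :=
    h.exists_toral_inf_conjSubgroup ((isTorus_iff c).mp hT.prop.2) a
  have hDr : IsTorusOfDim D r := by
    rw [← hr, ← hDl]
    exact IsToral.isTorusOfDim hD
  have hD1 := isTorusOfDim_conjSubgroup a⁻¹ hDr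
  have hD1K : conjSubgroup a⁻¹ D ≤ K := by
    have := conjSubgroup_mono a⁻¹ (hDle.trans inf_le_right)
    rwa [← conjSubgroup_mul, inv_mul_cancel, conjSubgroup_one] at this
  obtain ⟨k, hk, hle⟩ := h.exists_conj_le (isToral_of_isTorusOfDim hD1) hD1K hS
  have hD2 := isTorusOfDim_conjSubgroup k hD1
  -- The conjugate of `D` lies in `S` and has the same dimension `r`, so the Lie algebras agree and
  -- `S` lies in the conjugate.
  have hlie : c.lie S ≤ c.lie (conjSubgroup k (conjSubgroup a⁻¹ D)) := by
    refine (Submodule.eq_of_le_of_finrank_eq (lie_mono hle) ?_).ge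
    rw [c.finrank_lie_eq hD2, c.finrank_lie_eq hSr]
  have hSD := IsToral.le_of_lie_le (isToral_of_isTorusOfDim hSr)
    (isToral_of_isTorusOfDim hD2).isAbelian hlie
  rw [← conjSubgroup_mul] at hSD
  -- Both `T` and its conjugate by `k * a⁻¹` are maximal tori containing `S`, hence equal; and `(k *
  -- a⁻¹)⁻¹ = a * k⁻¹` represents the same point as `a`.
  refine ⟨k * a⁻¹, ?_, ?_⟩
  · refine mem_normalizer_of_conjSubgroup_eq ?_
    exact (h.maximalTorus_unique hS hT (isMaximalTorus_conjSubgroup hT _) hST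
      (hSD.trans (conjSubgroup_mono _ (hDle.trans inf_le_left)))).symm
  · rw [QuotientGroup.eq]
    simpa using hk

end LocalCoord.IsFixedPair
end SymOrbits
end

/-! ### The bijection -/

theorem mainTheorem10
    {E : Type*} [NormedAddCommGroup E] [NormedSpace ℝ E] [FiniteDimensional ℝ E]
    {G : Type*} [Group G] [TopologicalSpace G] [ChartedSpace E G] [LieGroup 𝓘(ℝ, E) ∞ G]
    [T2Space G] [CompactSpace G] [ConnectedSpace G]
    (K : Subgroup G) (hK : SymOrbits.IsIrreducibleSymmetricSpace E K)
    (hodd : ∃ n : ℕ, Odd n ∧ SymOrbits.IsLocallyEuclideanOfDim (G ⧸ K) n)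
    (hrank : ∃ r : ℕ, SymOrbits.HasRank K r ∧ SymOrbits.HasRank (⊤ : Subgroup G) (r + 1))
    (T : Subgroup G) (hT : SymOrbits.IsMaximalTorus ⊤ T)
    (hTK : ∃ S : Subgroup G, SymOrbits.IsMaximalTorus K S ∧ S ≤ T) :
    ∃ Φ : SymOrbits.WeylQuotient K T ≃ SymOrbits.oneDimOrbits T K,
      ∀ g : Subgroup.normalizer (T : Set G),
        (Φ (SymOrbits.weylClass K T g) : Set (G ⧸ K)) =
          MulAction.orbit T (QuotientGroup.mk (g : G)⁻¹ : G ⧸ K) := by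
  have : IsTopologicalGroup G := topologicalGroup_of_lieGroup 𝓘(ℝ, E) ∞
  obtain ⟨σ, hσ, -, -⟩ := hK
  obtain ⟨L, h⟩ := hσ.exists_isFixedPair
  obtain ⟨r, hKr, hGr⟩ := hrank
  obtain ⟨S, hS, hST⟩ := hTK
  set c := SymOrbits.chartCoord E G
  have hSr := h.isTorusOfDim_of_hasRank hS hKr
  have hTr := c.isFixedPair_id.isTorusOfDim_of_hasRank hT hGr
  have hTt := SymOrbits.isToral_of_isTorusOfDim hTr
  have hdim : ∀ a : G, SymOrbits.IsLocallyEuclideanOfDim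
      (MulAction.orbit T (QuotientGroup.mk a : G ⧸ K)) 1 ↔
        Module.finrank ℝ (c.lie (T ⊓ SymOrbits.conjSubgroup a K)) = r := fun a => by
    rw [c.isLocallyEuclideanOfDim_orbit_iff hTt h.isClosed, c.finrank_lie_eq hTr]
    omega
  let q : Subgroup.normalizer (T : Set G) → SymOrbits.oneDimOrbits T K := fun g =>
    ⟨MulAction.orbit T (QuotientGroup.mk (g : G)⁻¹ : G ⧸ K), ⟨_, rfl⟩,
      (hdim _).mpr (h.finrank_lie_stabilizer hS hSr hTt hST (inv_mem g.2))⟩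
  -- One direction makes the map independent of the representative chosen by `Function.surjInv`
  -- below, the other makes it injective.
  have hq : ∀ g g', SymOrbits.weylClass K T g = SymOrbits.weylClass K T g' ↔ q g = q g' :=
    fun g g' => SymOrbits.weylClass_eq_iff_orbit_eq.trans (Subtype.ext_iff (a1 := q g) (a2 := q g')).symm
  have hsurj : Function.Surjective (SymOrbits.weylClass K T) :=
    Quotient.mk_surjective.comp QuotientGroup.mk_surjective
  let f : SymOrbits.WeylQuotient K T → SymOrbits.oneDimOrbits T K :=
    fun x => q (Function.surjInv hsurj x)
  have hf : ∀ g, f (SymOrbits.weylClass K T g) = q g := fun g =>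
    (hq _ _).mp (Function.surjInv_eq hsurj _)
  refine ⟨Equiv.ofBijective f ⟨fun x y hxy => ?_, ?_⟩, fun g => congrArg Subtype.val (hf g)⟩
  · obtain ⟨g, rfl⟩ := hsurj x
    obtain ⟨g', rfl⟩ := hsurj y
    rw [hf, hf] at hxy
    exact (hq g g').mpr hxy
  · rintro ⟨O, ⟨x, rfl⟩, hO⟩
    obtain ⟨a, rfl⟩ := QuotientGroup.mk_surjective x
    obtain ⟨g, hg, hga⟩ := h.exists_mem_normalizer hS hSr hT hST ((hdim a).mp hO)
    refine ⟨SymOrbits.weylClass K T ⟨g, hg⟩, (hf _).trans (Subtype.ext ?_)⟩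
    exact congrArg (MulAction.orbit T) hga
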